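/- Let $(X,d)$ be a compact metric space with its Borel $\sigma$-algebra, let $P(X)$ be the set of Borel probability measures on $X$, and let $\mathrm{Lip}(X)$ be the set of Lipschitz functions $f:X\to\mathbb{R}$; for $x_0\in X$ put $\mathrm{Lip}(X,x_0)=\{f\in \mathrm{Lip}(X): f(x_0)=0\}$. Let $\phi:\mathbb{R}\to[-\infty,\infty]$ be proper, convex and lower semicontinuous with $\phi(1)=0$, with $1$ in the relative interior of $\operatorname{dom}\phi=\{\phi<\infty\}$, and strictly convex at $1$, i.e. $\lambda\phi(x_1)+(1-\lambda)\phi(x_2)>\phi(1)$ whenever $\lambda\in(0,1)$, $x_1,x_2\in\operatorname{dom}\phi$, $\lambda x_1+(1-\lambda)x_2=1$ and not $x_1=x_2=1$. Put $\phi'(\infty)=\lim_{x\to\infty}\phi(x)/x\in(-\infty,\infty]$ and $\phi_+^*(y)=\sup_{x\ge 0}\{xy-\phi(x)\}$, the convex conjugate of $\phi_+=\phi+i_{[0,\infty)}$, where $i_{[0,\infty)}$ is $0$ on $[0,\infty)$ and $\infty$ elsewhere. For $\mu,\nu\in P(X)$ with Lebesgue decomposition $\mu=\mu_c+\mu_s$,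 $\mu_c\ll\nu$, $\mu_s\perp\nu$, let \[ D_\phi(\mu\Vert\nu)=\int\phi\circ\frac{d\mu_c}{d\nu}\,d\nu+\phi'(\infty)\,\mu_s(X) \] (with $\infty\cdot 0=0$), and for $f\in\mathrm{Lip}(X)$ let \[ D_\phi^*(f\Vert\nu)=\sup_{\xi\in P(X)}\left\{\int f\,d\xi-D_\phi(\xi\Vert\nu)\right\}. \] Then for all $\mu,\nu\in P(X)$ and every $x_0\in X$, \[ D_\phi(\mu\Vert\nu)=\sup_{f\in \mathrm{Lip}(X)}\left\{\int f\,d\mu-D_\phi^*(f\Vert\nu)\right\}=\sup_{f\in \mathrm{Lip}(X,x_0)}\left\{\int f\,d\mu-D_\phi^*(f\Vert\nu)\right\}, \] and for every $f\in\mathrm{Lip}(X)$ the value $D_\phi^*(f\Vert\nu)$ is a real number and \[ D_\phi^*(f\Vert\nu)=\min\left\{\int\phi_+^*\circ(f-\gamma)\,d\nu+\gamma \;:\; \gamma\in\mathbb{R},\ \gamma\ge\sup f(X)-\phi'(\infty)\right\}, \] where the minimum is attained. -/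

import Mathlib

open MeasureTheory Filter
open scoped NNReal ENNReal

noncomputable section

namespace FDivergence

/-! ### Convex analysis of functions `φ : ℝ → [-∞, ∞]` -/

/-- The effective domain. -/
def effDom (φ : ℝ → EReal) : Set ℝ := {x | φ x < ⊤}

/-- `φ` is proper: its effective domain is nonempty and it never takes the value `-∞`. -/
def IsProper (φ : ℝ → EReal) : Prop := (effDom φ).Nonempty ∧ ∀ x, ⊥ < φ x

/-- Convexity of an extended real valued function
(in `EReal`, `0 * ⊤ = 0`, so `l = 0` and `l = 1` impose nothing). -/
def IsConvex (φ : ℝ → EReal) : Prop :=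
  ∀ x y l : ℝ, 0 ≤ l → l ≤ 1 →
    φ (l * x + (1 - l) * y) ≤ (l : EReal) * φ x + ((1 - l : ℝ) : EReal) * φ y

/-- Strict convexity at a single point `a`. -/
def IsStrictlyConvexAt (φ : ℝ → EReal) (a : ℝ) : Prop :=
  a ∈ effDom φ ∧
    ∀ l : ℝ, 0 < l → l < 1 → ∀ x ∈ effDom φ, ∀ y ∈ effDom φ,
      l * x + (1 - l) * y = a → ¬ (x = a ∧ y = a) →
        φ a < (l : EReal) * φ x + ((1 - l : ℝ) : EReal) * φ y

/-- The convex-analytic indicator `i_A`: `0` on `A` and `∞` off `A`. -/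
def convexIndicator (A : Set ℝ) (x : ℝ) : EReal :=
  open Classical in if x ∈ A then 0 else ⊤

/-- `φ₊ = φ + i_{[0, ∞)}`. -/
def plusPart (φ : ℝ → EReal) (x : ℝ) : EReal := φ x + convexIndicator (Set.Ici 0) x

/-- The convex conjugate `φ^*(y) = sup_x (x y - φ(x))`. -/
def conjugate (φ : ℝ → EReal) (y : ℝ) : EReal := ⨆ x : ℝ, (((x * y : ℝ) : EReal) - φ x)

/-- `φ'(∞) = lim_{x → ∞} φ(x) / x`. The limit exists in `[-∞, ∞]` whenever `φ` is proper and
convex. -/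
def slopeAtTop (φ : ℝ → EReal) : EReal := limUnder atTop (fun x : ℝ => φ x / (x : EReal))

/-! ### Integrals and divergences -/

variable {X : Type*}

/-- The Lebesgue integral of an extended real valued function: the integral of the positive part
minus the integral of the negative part. -/
def eintegral [MeasurableSpace X] (ν : Measure X) (g : X → EReal) : EReal :=
  ((∫⁻ x, (g x).toENNReal ∂ν : ℝ≥0∞) : EReal) - ((∫⁻ x, (-g x).toENNReal ∂ν : ℝ≥0∞) : EReal)

/-- The `f`-divergence `D_φ(μ ‖ ν) = ∫ φ(dμ_c/dν) dν + φ'(∞) μ_s(X)` of nonnegative measures, where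
`μ = μ_c + μ_s` is the Lebesgue decomposition with respect to `ν`. -/
def fDiv [MeasurableSpace X] (φ : ℝ → EReal) (μ ν : Measure X) : EReal :=
  eintegral ν (fun x => φ (μ.rnDeriv ν x).toReal)
    + slopeAtTop φ * ((μ.singularPart ν Set.univ : ℝ≥0∞) : EReal)

/-- The tight convex conjugate
`D_φ^*(f ‖ ν) = sup { ∫ f dξ - D_φ(ξ ‖ ν) : ξ a probability measure }`. -/
def tightConj [MeasurableSpace X] (φ : ℝ → EReal) (ν : Measure X) (f : X → ℝ) : EReal :=
  ⨆ ξ : ProbabilityMeasure X,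
    (((∫ x, f x ∂(ξ : Measure X) : ℝ) : EReal) - fDiv φ (ξ : Measure X) ν)

/-- `Lip(X)`: the Lipschitz functions `X → ℝ`. -/
def Lip (X : Type*) [MetricSpace X] : Set (X → ℝ) := {f | ∃ K : ℝ≥0, LipschitzWith K f}

/-- `Lip(X, x₀)`: the Lipschitz functions `X → ℝ` that vanish at `x₀`. -/
def LipAt [MetricSpace X] (x₀ : X) : Set (X → ℝ) := {f | f ∈ Lip X ∧ f x₀ = 0}

end FDivergence

end

/-! ### Convex conjugacy on the half line. -/

namespace FDivergence

/-! Fenchel–Moreau on the half line writes φ(r), for r ≥ 0, as the supremum of the affine functions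
r y - c with φ₊^*(y) ≤ c. Since φ₊^* is monotone, lowering y a little keeps c admissible, so only
slopes y strictly below φ'(∞) are needed (`eq_iSup_dualEpi`).

Integrating Young's inequality over the absolutely continuous part and using h ≤ φ'(∞) on the
singular part gives ∫ h dξ ≤ ∫ φ₊^*∘h dν + D_φ(ξ‖ν) (`integral_le_fDiv_add`). Conversely, a
measurable choice of nearly optimal slopes at dξ/dν, completed by a constant slope on the singular
part, nearly attains D_φ (`exists_measurable_lt_of_lt_fDiv`). The chosen slopes stay below some b <
φ'(∞), where φ₊^* is finite and continuous, so dominated convergence replaces them by Lipschitz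
functions (`exists_lipschitz_lt_of_lt_fDiv`). Restricting ξ to mass one makes both sides insensitive
to adding constants to h, which yields the two variational formulas.

The formula for D_φ^* is Lagrangian duality for the constraint of mass one. The pairs (mass,
objective) realised by ρν + tδ_x, with x a maximiser of f, form a convex set whose fibre over mass 1
lies below D_φ^*(f‖ν). As 1 is in the relative interior of dom φ, a non-vertical supporting line
exists there (`exists_supporting_slope`), and its slope is the optimal γ: large t forces γ ≥ sup f -
φ'(∞), and densities nearly attaining ∫ φ₊^*∘(f - γ) dν force the inequality missing from weak
duality (`exists_multiplier`). -/

/-- The conjugate `φ₊^*` of the restriction of `φ` to the half line. -/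
noncomputable abbrev conjPlus (φ : ℝ → EReal) (y : ℝ) : EReal := conjugate (plusPart φ) y

/-- The epigraph of `φ` over `[0, ∞)`. -/
def epiPlus (φ : ℝ → EReal) : Set (ℝ × ℝ) := {p | 0 ≤ p.1 ∧ φ p.1 ≤ (p.2 : EReal)}

/-- The part of the epigraph of `φ₊^*` lying strictly to the left of `φ'(∞)`. -/
def dualEpi (φ : ℝ → EReal) : Set (ℝ × ℝ) :=
  {p | (p.1 : EReal) < slopeAtTop φ ∧ conjPlus φ p.1 ≤ (p.2 : EReal)}

lemma young {φ : ℝ → EReal} {x : ℝ} (hx : 0 ≤ x) (y : ℝ) :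
    ((x * y : ℝ) : EReal) - φ x ≤ conjPlus φ y := by
  refine le_trans (le_of_eq ?_)
    (le_iSup (fun x : ℝ => (((x * y : ℝ) : EReal) - plusPart φ x)) x)
  simp [plusPart, convexIndicator, hx]

lemma young_of_mem {φ : ℝ → EReal} {p : ℝ × ℝ} (hp : p ∈ epiPlus φ) (y : ℝ) :
    ((p.1 * y - p.2 : ℝ) : EReal) ≤ conjPlus φ y := by
  refine le_trans ?_ (young hp.1 y)
  rw [EReal.coe_sub]
  exact EReal.sub_le_sub le_rfl hp.2

lemma conjPlus_le {φ : ℝ → EReal} (hbot : ∀ x, ⊥ < φ x) {y : ℝ} {a : EReal}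
    (h : ∀ p ∈ epiPlus φ, ((p.1 * y - p.2 : ℝ) : EReal) ≤ a) : conjPlus φ y ≤ a := by
  refine iSup_le fun x => ?_
  by_cases hx : 0 ≤ x
  · simp only [plusPart, convexIndicator, Set.mem_Ici, hx, if_true, add_zero]
    by_cases htop : φ x = ⊤
    · simp [htop]
    · lift φ x to ℝ using ⟨htop, (hbot x).ne'⟩ with c hc
      have := h (x, c) ⟨hx, hc.symm.le⟩
      simpa [EReal.coe_sub] using this
  · simp [plusPart, convexIndicator, hx, EReal.add_top_of_ne_bot (hbot x).ne']

lemma conjPlus_eq_iSup {φ : ℝ → EReal} (hbot : ∀ x, ⊥ < φ x) (y : ℝ) :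
    conjPlus φ y = ⨆ p : epiPlus φ, ((y * p.1.1 - p.1.2 : ℝ) : EReal) := by
  refine le_antisymm (conjPlus_le hbot fun p hp => ?_) (iSup_le fun p => ?_)
  · rw [mul_comm]
    exact le_iSup (fun p : epiPlus φ => ((y * p.1.1 - p.1.2 : ℝ) : EReal)) ⟨p, hp⟩
  · rw [mul_comm]
    exact young_of_mem p.2 y

lemma conjPlus_mono {φ : ℝ → EReal} (hbot : ∀ x, ⊥ < φ x) : Monotone (conjPlus φ) := by
  intro y z hyz
  refine conjPlus_le hbot fun p hp => le_trans ?_ (young_of_mem hp z)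
  exact_mod_cast sub_le_sub_right (mul_le_mul_of_nonneg_left hyz hp.1) _

/-- The point (1, 0) of the epigraph gives this bound. It keeps φ₊^* away from ⊥ and supplies the
integrable minorant for φ₊^* ∘ h. -/
lemma self_le_conjPlus {φ : ℝ → EReal} (hone : φ 1 = 0) (y : ℝ) :
    (y : EReal) ≤ conjPlus φ y := by
  simpa using young_of_mem (φ := φ) (p := (1, 0)) ⟨zero_le_one, by simp [hone]⟩ y

lemma convex_epiPlus {φ : ℝ → EReal} (hconvex : IsConvex φ) : Convex ℝ (epiPlus φ) := by
  rintro ⟨x, c⟩ ⟨hx, hc⟩ ⟨y, d⟩ ⟨hy, hd⟩ a b ha hb hab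
  obtain rfl : b = 1 - a := by linarith
  refine ⟨?_, ?_⟩
  · simp only [Prod.smul_mk, Prod.mk_add_mk, smul_eq_mul]
    simp only at hx hy
    positivity
  · have h := hconvex x y a ha (by linarith)
    simp only [Prod.smul_mk, Prod.mk_add_mk, smul_eq_mul]
    refine h.trans ?_
    rw [EReal.coe_add, EReal.coe_mul, EReal.coe_mul]
    exact add_le_add (mul_le_mul_of_nonneg_left hc (by exact_mod_cast ha))
      (mul_le_mul_of_nonneg_left hd (by exact_mod_cast hb))

lemma isClosed_epiPlus {φ : ℝ → EReal} (hlsc : LowerSemicontinuous φ) :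
    IsClosed (epiPlus φ) := by
  have h1 : IsClosed {p : ℝ × ℝ | 0 ≤ p.1} := isClosed_le continuous_const continuous_fst
  have h2 : IsClosed {p : ℝ × ℝ | φ p.1 ≤ (p.2 : EReal)} :=
    hlsc.isClosed_epigraph.preimage
      (continuous_fst.prodMk (continuous_coe_real_ereal.comp continuous_snd))
  exact h1.inter h2

/-- Hahn–Banach for a point and the closed convex epigraph, with the functional in coordinates. The
sign of b is left open, since the separating line may be vertical. -/
lemma exists_separating {φ : ℝ → EReal} (hconvex : IsConvex φ) (hlsc : LowerSemicontinuous φ)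
    {r M : ℝ} (hM : (M : EReal) < φ r) :
    ∃ a b u : ℝ, a * r + b * M < u ∧ ∀ p ∈ epiPlus φ, u < a * p.1 + b * p.2 := by
  have hnot : ((r, M) : ℝ × ℝ) ∉ epiPlus φ := fun h => (not_le.2 hM) h.2
  obtain ⟨f, u, h1, h2⟩ := geometric_hahn_banach_point_closed (convex_epiPlus hconvex)
    (isClosed_epiPlus hlsc) hnot
  have key : ∀ p : ℝ × ℝ, f p = f (1, 0) * p.1 + f (0, 1) * p.2 := by
    intro p
    have : p = p.1 • ((1, 0) : ℝ × ℝ) + p.2 • ((0, 1) : ℝ × ℝ) := by ext <;> simp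
    conv_lhs => rw [this]
    simp only [map_add, map_smul, smul_eq_mul]
    ring
  refine ⟨f (1, 0), f (0, 1), u, ?_, fun p hp => ?_⟩
  · rw [key] at h1; exact h1
  · rw [← key]; exact h2 p hp

lemma exists_affine_of_separating {φ : ℝ → EReal} (hbot : ∀ x, ⊥ < φ x) {r M a b u : ℝ}
    (hb : 0 < b) (h1 : a * r + b * M < u) (h2 : ∀ p ∈ epiPlus φ, u < a * p.1 + b * p.2) :
    ∃ y c : ℝ, conjPlus φ y ≤ c ∧ M < r * y - c := by
  refine ⟨-a / b, -u / b, conjPlus_le hbot fun p hp => ?_, ?_⟩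
  · have := h2 p hp
    have h : p.1 * (-a / b) - p.2 ≤ -u / b := by
      rw [← sub_nonneg]
      have : -u / b - (p.1 * (-a / b) - p.2) = (a * p.1 + b * p.2 - u) / b := by
        field_simp; ring
      rw [this]
      exact div_nonneg (by linarith) hb.le
    exact_mod_cast h
  · rw [← sub_pos]
    have : r * (-a / b) - -u / b - M = (u - (a * r + b * M)) / b := by
      field_simp; ring
    rw [this]
    exact div_pos (by linarith) hb

/-- Fenchel–Moreau on the half line. -/
lemma exists_affine_minorant {φ : ℝ → EReal} (hbot : ∀ x, ⊥ < φ x) (hconvex : IsConvex φ)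
    (hlsc : LowerSemicontinuous φ) (hone : φ 1 = 0) {r M : ℝ}
    (hM : (M : EReal) < φ r) : ∃ y c : ℝ, conjPlus φ y ≤ c ∧ M < r * y - c := by
  obtain ⟨a, b, u, h1, h2⟩ := exists_separating hconvex hlsc hM
  have hmem : ∀ t : ℝ, 0 ≤ t → ((1, t) : ℝ × ℝ) ∈ epiPlus φ := fun t ht =>
    ⟨zero_le_one, by simpa [hone] using ht⟩
  -- The epigraph contains the upward ray over 1; with b < 0 the functional would be unbounded below
  -- along it.
  have hb : 0 ≤ b := by
    by_contra! hb
    have h := h2 _ (hmem (|a - u| / (-b)) (div_nonneg (abs_nonneg _) (by linarith)))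
    have : b * (|a - u| / (-b)) = -|a - u| := by
      have := hb.ne
      field_simp
    simp only [this] at h
    linarith [le_abs_self (a - u)]
  -- Vertical separation occurs only for r outside the domain. A non-vertical minorant, found by
  -- separating (1, -1), is then tilted by a large multiple k of the vertical functional: this does
  -- not raise it over the epigraph, and raises it above M at r.
  rcases hb.eq_or_lt with rfl | hb
  · obtain ⟨a', b', u', h1', h2'⟩ := exists_separating hconvex hlsc (r := 1) (M := -1)
      (by rw [hone]; exact_mod_cast (by norm_num : (-1 : ℝ) < 0))
    have hb' : 0 < b' := by
      have := h2' _ (hmem 0 le_rfl)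
      simp only at this
      linarith
    obtain ⟨y, c, hy, -⟩ := exists_affine_of_separating hbot hb' h1' h2'
    have hpos : 0 < u - a * r := by linarith
    obtain ⟨k, hk⟩ : ∃ k : ℝ, 0 ≤ k ∧ M < r * y - c + k * (u - a * r) := by
      refine ⟨|M - (r * y - c)| / (u - a * r) + 1, by positivity, ?_⟩
      rw [add_mul, div_mul_cancel₀ _ hpos.ne']
      linarith [le_abs_self (M - (r * y - c))]
    refine ⟨y - k * a, c - k * u, conjPlus_le hbot fun p hp => ?_, by linarith⟩
    have h3 : p.1 * y - p.2 ≤ c := by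
      exact_mod_cast (young_of_mem hp y).trans hy
    have h4 := h2 p hp
    have h5 : 0 ≤ k * (a * p.1 - u) := mul_nonneg hk.1 (by linarith)
    have : p.1 * (y - k * a) - p.2 ≤ c - k * u := by linarith
    exact_mod_cast this
  · exact exists_affine_of_separating hbot hb h1 h2

/-- `φ'(∞)` is the supremum of the effective domain of `φ₊^*`. -/
lemma slopeAtTop_eq {φ : ℝ → EReal} (hbot : ∀ x, ⊥ < φ x) (hconvex : IsConvex φ)
    (hlsc : LowerSemicontinuous φ) (hone : φ 1 = 0) :
    slopeAtTop φ = ⨆ y ∈ effDom (conjPlus φ), ((y : ℝ) : EReal) := by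
  set S : EReal := ⨆ y ∈ effDom (conjPlus φ), ((y : ℝ) : EReal) with hS
  refine Tendsto.limUnder_eq (tendsto_order.2 ⟨fun a ha => ?_, fun a ha => ?_⟩)
  -- Lower bound: Young's inequality with y in the domain gives φ(x)/x ≥ y - c/x, which tends to y >
  -- a.
  · obtain ⟨y, hy⟩ := lt_iSup_iff.1 ha
    obtain ⟨hyd, hay⟩ := lt_iSup_iff.1 hy
    have hc : conjPlus φ y ≠ ⊥ := ((EReal.bot_lt_coe y).trans_le (self_le_conjPlus hone y)).ne'
    obtain ⟨c, hc⟩ : ∃ c : ℝ, conjPlus φ y = c :=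
      ⟨_, (EReal.coe_toReal (ne_of_lt hyd) hc).symm⟩
    have ht : Tendsto (fun x : ℝ => ((y - c / x : ℝ) : EReal)) atTop (nhds (y : EReal)) := by
      refine (continuous_coe_real_ereal.tendsto y).comp ?_
      simpa using tendsto_const_nhds.sub (tendsto_const_nhds.div_atTop (tendsto_id (α := ℝ)))
    filter_upwards [ht.eventually_const_lt hay, eventually_gt_atTop 0] with x hx hx0
    refine hx.trans_le ?_
    have h := young (φ := φ) hx0.le y
    rw [hc] at h
    by_cases htop : φ x = ⊤
    · rw [htop, EReal.top_div_of_pos_ne_top (by exact_mod_cast hx0) (EReal.coe_ne_top x)]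
      exact le_top
    · lift φ x to ℝ using ⟨htop, (hbot x).ne'⟩ with d hd
      have h' : x * y - d ≤ c := by exact_mod_cast h
      rw [← EReal.coe_div]
      have : y - c / x ≤ d / x := by
        rw [sub_le_iff_le_add, ← add_div, le_div_iff₀ hx0]; linarith
      exact_mod_cast this
  · have hStop : S ≠ ⊤ := (lt_of_lt_of_le ha le_top).ne
    have hdom : ∃ y, y ∈ effDom (conjPlus φ) := by
      obtain ⟨y, c, hy, -⟩ := exists_affine_minorant hbot hconvex hlsc hone (r := 1) (M := -1)
        (by rw [hone]; exact_mod_cast (by norm_num : (-1 : ℝ) < 0))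
      exact ⟨y, hy.trans_lt (EReal.coe_lt_top c)⟩
    have hSbot : S ≠ ⊥ := by
      obtain ⟨y, hy⟩ := hdom
      exact ((EReal.bot_lt_coe y).trans_le (le_iSup₂ (f := fun y _ => ((y : ℝ) : EReal)) y hy)).ne'
    obtain ⟨σ, hσ⟩ : ∃ σ : ℝ, S = σ := ⟨_, (EReal.coe_toReal hStop hSbot).symm⟩
    rw [hσ] at ha
    have ht : Tendsto (fun x : ℝ => ((σ - σ / x : ℝ) : EReal)) atTop (nhds (σ : EReal)) := by
      refine (continuous_coe_real_ereal.tendsto σ).comp ?_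
      simpa using tendsto_const_nhds.sub (tendsto_const_nhds.div_atTop (tendsto_id (α := ℝ)))
    filter_upwards [ht.eventually_lt_const ha, eventually_ge_atTop 1] with x hx hx1
    refine lt_of_le_of_lt ?_ hx
    have hx0 : 0 < x := by linarith
    -- An affine minorant x y - c has y ≤ σ, and c ≥ y because φ(1) = 0; hence it is at most (x -
    -- 1)y ≤ (x - 1)σ for x ≥ 1.
    have hle : φ x ≤ (((x - 1) * σ : ℝ) : EReal) := by
      by_contra! hlt
      obtain ⟨y, c, hy, hyc⟩ := exists_affine_minorant hbot hconvex hlsc hone hlt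
      have h1 : y ≤ c := by exact_mod_cast (self_le_conjPlus hone y).trans hy
      have h2 : y ≤ σ := by
        have := le_iSup₂ (f := fun y (_ : y ∈ effDom (conjPlus φ)) => ((y : ℝ) : EReal)) y
          (hy.trans_lt (EReal.coe_lt_top c))
        rw [← hS, hσ] at this
        exact_mod_cast this
      nlinarith
    refine (EReal.div_le_div_right_of_nonneg (by exact_mod_cast hx0.le) hle).trans ?_
    rw [← EReal.coe_div]
    have : (x - 1) * σ / x ≤ σ - σ / x := by
      apply le_of_eq; field_simp
    exact_mod_cast this

lemma le_slopeAtTop {φ : ℝ → EReal} (hbot : ∀ x, ⊥ < φ x) (hconvex : IsConvex φ)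
    (hlsc : LowerSemicontinuous φ) (hone : φ 1 = 0)
    {y : ℝ} (hy : conjPlus φ y < ⊤) : (y : EReal) ≤ slopeAtTop φ := by
  rw [slopeAtTop_eq hbot hconvex hlsc hone]
  exact le_iSup₂ (f := fun y (_ : y ∈ effDom (conjPlus φ)) => ((y : ℝ) : EReal)) y hy

lemma conjPlus_lt_top {φ : ℝ → EReal} (hbot : ∀ x, ⊥ < φ x) (hconvex : IsConvex φ)
    (hlsc : LowerSemicontinuous φ) (hone : φ 1 = 0)
    {y : ℝ} (hy : (y : EReal) < slopeAtTop φ) : conjPlus φ y < ⊤ := by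
  rw [slopeAtTop_eq hbot hconvex hlsc hone] at hy
  obtain ⟨z, hz⟩ := lt_iSup_iff.1 hy
  obtain ⟨hzd, hyz⟩ := lt_iSup_iff.1 hz
  exact (conjPlus_mono hbot (by exact_mod_cast hyz.le)).trans_lt hzd

lemma coe_toReal_conjPlus {φ : ℝ → EReal} (hbot : ∀ x, ⊥ < φ x) (hconvex : IsConvex φ)
    (hlsc : LowerSemicontinuous φ) (hone : φ 1 = 0)
    {y : ℝ} (hy : (y : EReal) < slopeAtTop φ) :
    ((conjPlus φ y).toReal : EReal) = conjPlus φ y :=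
  EReal.coe_toReal (conjPlus_lt_top hbot hconvex hlsc hone hy).ne
    ((EReal.bot_lt_coe y).trans_le (self_le_conjPlus hone y)).ne'

lemma bot_lt_slopeAtTop {φ : ℝ → EReal} (hbot : ∀ x, ⊥ < φ x) (hconvex : IsConvex φ)
    (hlsc : LowerSemicontinuous φ) (hone : φ 1 = 0) : ⊥ < slopeAtTop φ := by
  obtain ⟨y, c, hy, -⟩ := exists_affine_minorant hbot hconvex hlsc hone (r := 1) (M := -1)
    (by rw [hone]; exact_mod_cast (by norm_num : (-1 : ℝ) < 0))
  exact (EReal.bot_lt_coe y).trans_le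
    (le_slopeAtTop hbot hconvex hlsc hone (hy.trans_lt (EReal.coe_lt_top c)))

lemma exists_lt_slopeAtTop {φ : ℝ → EReal} (hbot : ∀ x, ⊥ < φ x) (hconvex : IsConvex φ)
    (hlsc : LowerSemicontinuous φ) (hone : φ 1 = 0) : ∃ y : ℝ, (y : EReal) < slopeAtTop φ := by
  obtain ⟨y, -, hy⟩ := EReal.lt_iff_exists_real_btwn.1 (bot_lt_slopeAtTop hbot hconvex hlsc hone)
  exact ⟨y, hy⟩

/-- Strict inequality at M leaves room to decrease the slope, and by monotonicity of φ₊^* the same c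
still bounds the conjugate. -/
lemma exists_mem_dualEpi {φ : ℝ → EReal} (hbot : ∀ x, ⊥ < φ x) (hconvex : IsConvex φ)
    (hlsc : LowerSemicontinuous φ) (hone : φ 1 = 0)
    {r M : ℝ} (hM : (M : EReal) < φ r) :
    ∃ p ∈ dualEpi φ, M < r * p.1 - p.2 := by
  obtain ⟨y, c, hy, hM⟩ := exists_affine_minorant hbot hconvex hlsc hone hM
  have ht : Tendsto (fun z : ℝ => r * z - c) (nhdsWithin y (Set.Iio y)) (nhds (r * y - c)) := by
    refine Tendsto.mono_left ?_ nhdsWithin_le_nhds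
    exact Continuous.tendsto (by fun_prop) y
  obtain ⟨z, hz, hzy⟩ := ((ht.eventually_const_lt hM).and self_mem_nhdsWithin).exists
  refine ⟨(z, c), ⟨?_, (conjPlus_mono hbot (le_of_lt hzy)).trans hy⟩, hz⟩
  exact lt_of_lt_of_le (by exact_mod_cast hzy)
    (le_slopeAtTop hbot hconvex hlsc hone (hy.trans_lt (EReal.coe_lt_top c)))

lemma eq_iSup_dualEpi {φ : ℝ → EReal} (hbot : ∀ x, ⊥ < φ x) (hconvex : IsConvex φ)
    (hlsc : LowerSemicontinuous φ) (hone : φ 1 = 0)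
    {r : ℝ} (hr : 0 ≤ r) :
    φ r = ⨆ p : dualEpi φ, ((r * p.1.1 - p.1.2 : ℝ) : EReal) := by
  refine le_antisymm (EReal.le_of_forall_lt_iff_le.1 ?_) (iSup_le fun p => ?_)
  · intro M hM
    by_contra! hlt
    obtain ⟨p, hp, hMp⟩ := exists_mem_dualEpi hbot hconvex hlsc hone hlt
    refine absurd (hM.trans_le' ?_) (lt_irrefl _)
    exact le_trans (by exact_mod_cast hMp.le)
      (le_iSup (fun p : dualEpi φ => ((r * p.1.1 - p.1.2 : ℝ) : EReal)) ⟨p, hp⟩)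
  · by_cases htop : φ r = ⊤
    · simp [htop]
    · have h := (young (φ := φ) hr p.1.1).trans p.2.2
      lift φ r to ℝ using ⟨htop, (hbot r).ne'⟩ with d hd
      have h' : r * p.1.1 - d ≤ p.1.2 := by exact_mod_cast h
      have : r * p.1.1 - p.1.2 ≤ d := by linarith
      exact_mod_cast this

/-- A supremum of affine functions is convex, and a finite convex function is continuous on an open
interval. This is what lets limits of Lipschitz functions pass through φ₊^*. -/
lemma continuousOn_toReal_conjPlus {φ : ℝ → EReal} (hbot : ∀ x, ⊥ < φ x) (hconvex : IsConvex φ)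
    (hlsc : LowerSemicontinuous φ) (hone : φ 1 = 0) :
    ContinuousOn (fun y => (conjPlus φ y).toReal) {y : ℝ | (y : EReal) < slopeAtTop φ} := by
  have hopen : IsOpen {y : ℝ | (y : EReal) < slopeAtTop φ} :=
    isOpen_lt continuous_coe_real_ereal continuous_const
  have hord : Set.OrdConnected {y : ℝ | (y : EReal) < slopeAtTop φ} :=
    ⟨fun x _ y hy z hz =>
      lt_of_le_of_lt (EReal.coe_le_coe_iff.2 hz.2) (show (y : EReal) < _ from hy)⟩
  refine ConvexOn.continuousOn hopen ⟨hord.convex, fun x hx y hy a b ha hb hab => ?_⟩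
  have hz := hord.convex hx hy ha hb hab
  rw [← EReal.coe_le_coe_iff, coe_toReal_conjPlus hbot hconvex hlsc hone hz]
  refine conjPlus_le hbot fun p hp => ?_
  have h1 := young_of_mem hp x
  have h2 := young_of_mem hp y
  rw [← coe_toReal_conjPlus hbot hconvex hlsc hone hx, EReal.coe_le_coe_iff] at h1
  rw [← coe_toReal_conjPlus hbot hconvex hlsc hone hy, EReal.coe_le_coe_iff] at h2
  rw [EReal.coe_le_coe_iff]
  simp only [smul_eq_mul]
  have e : p.1 * (a * x + b * y) - p.2 = a * (p.1 * x - p.2) + b * (p.1 * y - p.2) := by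
    linear_combination p.2 * hab
  rw [e]
  exact add_le_add (mul_le_mul_of_nonneg_left h1 ha) (mul_le_mul_of_nonneg_left h2 hb)

/-! ### Integrals of extended real valued functions and measurable selection. -/

section Integral

variable {X : Type*} [MeasurableSpace X] {ν : Measure X}

lemma eintegral_mono {g₁ g₂ : X → EReal} (h : ∀ x, g₁ x ≤ g₂ x) :
    eintegral ν g₁ ≤ eintegral ν g₂ := by
  refine EReal.sub_le_sub ?_ ?_
  · exact EReal.coe_ennreal_le_coe_ennreal_iff.2
      (lintegral_mono fun x => EReal.toENNReal_le_toENNReal (h x))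
  · exact EReal.coe_ennreal_le_coe_ennreal_iff.2
      (lintegral_mono fun x => EReal.toENNReal_le_toENNReal (EReal.neg_le_neg_iff.2 (h x)))

lemma eintegral_congr_ae {g₁ g₂ : X → EReal} (h : g₁ =ᵐ[ν] g₂) :
    eintegral ν g₁ = eintegral ν g₂ := by
  have h1 := lintegral_congr_ae (h.fun_comp EReal.toENNReal)
  have h2 := lintegral_congr_ae (h.fun_comp fun y => (-y).toENNReal)
  simp only [Function.comp_apply] at h1 h2
  simp only [eintegral, h1, h2]

lemma eintegral_coe {u : X → ℝ} (hu : Integrable u ν) :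
    eintegral ν (fun x => (u x : EReal)) = ((∫ x, u x ∂ν : ℝ) : EReal) := by
  have h1 : ∫⁻ x, ENNReal.ofReal (u x) ∂ν ≠ ⊤ := hu.lintegral_lt_top.ne
  have h2 : ∫⁻ x, ENNReal.ofReal (-u x) ∂ν ≠ ⊤ := hu.neg.lintegral_lt_top.ne
  rw [integral_eq_lintegral_pos_part_sub_lintegral_neg_part hu, eintegral, EReal.coe_sub]
  simp only [EReal.real_coe_toENNReal, ← EReal.coe_neg]
  rw [← EReal.coe_ennreal_toReal h1, ← EReal.coe_ennreal_toReal h2]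

/-- An extended real valued function above an integrable one is integrated by adding the
integral of the difference. -/
lemma eintegral_eq_add_lintegral {u : X → ℝ} {g : X → EReal} (hu : Integrable u ν)
    (hum : Measurable u) (hg : Measurable g) (h : ∀ x, (u x : EReal) ≤ g x) :
    eintegral ν g = ((∫ x, u x ∂ν : ℝ) : EReal)
      + ((∫⁻ x, (g x - u x).toENNReal ∂ν : ℝ≥0∞) : EReal) := by
  have h1 : ∫⁻ x, ENNReal.ofReal (u x) ∂ν ≠ ⊤ := hu.lintegral_lt_top.ne
  have h2 : ∫⁻ x, ENNReal.ofReal (-u x) ∂ν ≠ ⊤ := hu.neg.lintegral_lt_top.ne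
  -- The identity g = u + (g - u) in terms of positive and negative parts, rearranged so that no
  -- subtraction occurs and it can be integrated in `ℝ≥0∞`.
  have hpt : ∀ x, (g x).toENNReal + ENNReal.ofReal (-u x)
      = (-g x).toENNReal + (ENNReal.ofReal (u x) + (g x - u x).toENNReal) := by
    intro x
    have hx := h x
    by_cases htop : g x = ⊤
    · simp [htop]
    · lift g x to ℝ using ⟨htop, ((EReal.bot_lt_coe _).trans_le hx).ne'⟩ with d hd
      have hx : u x ≤ d := by exact_mod_cast hx
      rw [← EReal.coe_neg, ← EReal.coe_sub]
      simp only [EReal.real_coe_toENNReal]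
      rw [← ENNReal.toReal_eq_toReal_iff' (by simp) (by simp), ENNReal.toReal_add (by simp)
        (by simp), ENNReal.toReal_add (by simp) (by simp), ENNReal.toReal_add (by simp) (by simp)]
      simp only [ENNReal.toReal_ofReal']
      have e1 := max_zero_sub_max_neg_zero_eq_self d
      have e2 := max_zero_sub_max_neg_zero_eq_self (u x)
      rw [max_eq_left (sub_nonneg.2 hx)]
      linarith
  have hneg : ∫⁻ x, (-g x).toENNReal ∂ν ≠ ⊤ := by
    refine ne_top_of_le_ne_top h2 (lintegral_mono fun x => ?_)
    rw [← EReal.real_coe_toENNReal, EReal.coe_neg]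
    exact EReal.toENNReal_le_toENNReal (EReal.neg_le_neg_iff.2 (h x))
  have hint : ∫⁻ x, (g x).toENNReal ∂ν + ∫⁻ x, ENNReal.ofReal (-u x) ∂ν
      = ∫⁻ x, (-g x).toENNReal ∂ν
        + (∫⁻ x, ENNReal.ofReal (u x) ∂ν + ∫⁻ x, (g x - u x).toENNReal ∂ν) := by
    have hnm : Measurable fun x => ENNReal.ofReal (-u x) := hum.neg.ennreal_ofReal
    have hgn : Measurable fun x => (-g x).toENNReal := hg.neg.ereal_toENNReal
    rw [← lintegral_add_right _ hnm, ← lintegral_add_left hum.ennreal_ofReal,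
      ← lintegral_add_left hgn]
    exact lintegral_congr hpt
  rw [integral_eq_lintegral_pos_part_sub_lintegral_neg_part hu, eintegral]
  generalize ∫⁻ x, (g x).toENNReal ∂ν = A at *
  generalize ∫⁻ x, (-g x).toENNReal ∂ν = B at *
  generalize ∫⁻ x, (g x - u x).toENNReal ∂ν = C at *
  generalize ∫⁻ x, ENNReal.ofReal (u x) ∂ν = P at *
  generalize ∫⁻ x, ENNReal.ofReal (-u x) ∂ν = N at *
  lift B to ℝ≥0 using hneg
  lift P to ℝ≥0 using h1
  lift N to ℝ≥0 using h2
  by_cases hC : C = ⊤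
  · have hA : A = ⊤ := by
      by_contra hA
      lift A to ℝ≥0 using hA
      rw [hC] at hint
      simp at hint
    rw [hA, hC]
    simp
    rfl
  · have hA : A ≠ ⊤ := by
      lift C to ℝ≥0 using hC
      intro hA
      rw [hA] at hint
      simp at hint
      exact absurd hint.symm (by exact_mod_cast ENNReal.coe_ne_top)
    lift A to ℝ≥0 using hA
    lift C to ℝ≥0 using hC
    have : (A : ℝ) + N = B + (P + C) := by exact_mod_cast hint
    change ((A : ℝ) : EReal) - ((B : ℝ) : EReal) = ((P - N : ℝ) : EReal) + ((C : ℝ) : EReal)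
    rw [← EReal.coe_sub, ← EReal.coe_add, EReal.coe_eq_coe_iff]
    linarith

lemma exists_integrable_of_eintegral_ne_top {u : X → ℝ} {g : X → EReal} (hu : Integrable u ν)
    (hum : Measurable u) (hg : Measurable g) (h : ∀ x, (u x : EReal) ≤ g x)
    (htop : eintegral ν g ≠ ⊤) :
    ∃ G : X → ℝ, Integrable G ν ∧ (∀ᵐ x ∂ν, g x = G x) ∧
      eintegral ν g = ((∫ x, G x ∂ν : ℝ) : EReal) := by
  have hfin : ∫⁻ x, (g x - u x).toENNReal ∂ν ≠ ⊤ := by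
    intro hC
    rw [eintegral_eq_add_lintegral hu hum hg h, hC] at htop
    exact htop (by simp)
  have hmeas : Measurable fun x => (g x - u x).toENNReal :=
    (hg.sub hum.coe_real_ereal).ereal_toENNReal
  have hae : ∀ᵐ x ∂ν, g x = ((g x).toReal : EReal) := by
    filter_upwards [ae_lt_top hmeas hfin] with x hx
    refine (EReal.coe_toReal ?_ ((EReal.bot_lt_coe _).trans_le (h x)).ne').symm
    intro hgx
    simp [hgx] at hx
  have hG : Integrable (fun x => (g x).toReal) ν := by
    have hd : Integrable (fun x => (g x - u x).toENNReal.toReal) ν :=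
      integrable_toReal_of_lintegral_ne_top hmeas.aemeasurable hfin
    refine (hu.add hd).congr ?_
    filter_upwards [hae] with x hx
    have hle := h x
    simp only [Pi.add_apply]
    generalize (g x).toReal = d at hx ⊢
    rw [hx] at hle ⊢
    rw [EReal.coe_le_coe_iff] at hle
    rw [← EReal.coe_sub, EReal.real_coe_toENNReal, ENNReal.toReal_ofReal (by linarith)]
    ring
  refine ⟨_, hG, hae, ?_⟩
  rw [← eintegral_coe hG]
  exact eintegral_congr_ae hae

/-- Monotone convergence applied to the nonnegative differences from the integrable first term. -/
lemma exists_lt_integral_of_monotone {F : ℕ → X → ℝ} {g : X → EReal} (hF : ∀ n, Integrable (F n) ν)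
    (hFm : ∀ n, Measurable (F n)) (hmono : ∀ x, Monotone fun n => F n x)
    (hg : ∀ x, g x = ⨆ n, (F n x : EReal)) {M : ℝ} (hM : (M : EReal) < eintegral ν g) :
    ∃ n, M < ∫ x, F n x ∂ν := by
  have hgm : Measurable g := by
    rw [funext hg]
    exact Measurable.iSup fun n => (hFm n).coe_real_ereal
  have hle : ∀ n x, (F n x : EReal) ≤ g x := fun n x => by
    rw [hg]; exact le_iSup (fun n => (F n x : EReal)) n
  by_contra! hcon
  have hlim : ∫⁻ x, (g x - F 0 x).toENNReal ∂ν = ⨆ n, ∫⁻ x, ENNReal.ofReal (F n x - F 0 x) ∂ν := by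
    have hm : ∀ n, Measurable fun x => ENNReal.ofReal (F n x - F 0 x) :=
      fun n => ((hFm n).sub (hFm 0)).ennreal_ofReal
    rw [← lintegral_iSup hm
      (fun m n hmn x => ENNReal.ofReal_le_ofReal (sub_le_sub_right (hmono x hmn) _))]
    refine lintegral_congr fun x => ?_
    refine tendsto_nhds_unique (f := fun n => ENNReal.ofReal (F n x - F 0 x)) (l := atTop) ?_
      (tendsto_atTop_iSup fun m n hmn =>
        ENNReal.ofReal_le_ofReal (sub_le_sub_right (hmono x hmn) _))
    have h1 : Tendsto (fun n => (F n x : EReal)) atTop (nhds (g x)) := by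
      rw [hg]
      exact tendsto_atTop_iSup fun m n hmn => EReal.coe_le_coe_iff.2 (hmono x hmn)
    have h2 : Tendsto (fun n => ((F n x : EReal) + ((-F 0 x : ℝ) : EReal))) atTop
        (nhds (g x + ((-F 0 x : ℝ) : EReal))) :=
      (EReal.continuousAt_add (p := (g x, ((-F 0 x : ℝ) : EReal))) (Or.inr (EReal.coe_ne_bot _))
        (Or.inr (EReal.coe_ne_top _))).tendsto.comp (h1.prodMk_nhds tendsto_const_nhds)
    have h3 := (EReal.continuous_toENNReal.tendsto _).comp h2
    simp only [Function.comp_def, ← EReal.coe_add, EReal.real_coe_toENNReal,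
      ← sub_eq_add_neg] at h3
    rwa [EReal.coe_neg, ← sub_eq_add_neg] at h3
  have hbound : ∫⁻ x, (g x - F 0 x).toENNReal ∂ν ≤ ENNReal.ofReal (M - ∫ x, F 0 x ∂ν) := by
    rw [hlim]
    refine iSup_le fun n => ?_
    have hi : Integrable (fun x => F n x - F 0 x) ν := (hF n).sub (hF 0)
    rw [← ofReal_integral_eq_lintegral_ofReal hi
      (Eventually.of_forall fun x => sub_nonneg.2 (hmono x (Nat.zero_le n)))]
    refine ENNReal.ofReal_le_ofReal ?_
    rw [integral_sub (hF n) (hF 0)]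
    exact sub_le_sub_right (hcon n) _
  rw [eintegral_eq_add_lintegral (hF 0) (hFm 0) hgm (hle 0)] at hM
  refine absurd hM (not_lt.2 ?_)
  refine (add_le_add le_rfl (EReal.coe_ennreal_le_coe_ennreal_iff.2 hbound)).trans ?_
  rw [EReal.coe_ennreal_ofReal, max_eq_left (sub_nonneg.2 (hcon 0)), ← EReal.coe_add]
  simp

/-- A measurable choice of the best among the first terms of a sequence of affine functions. -/
lemma exists_measurable_argmax (u : ℕ → ℝ × ℝ) {h : X → ℝ} (hh : Measurable h) :
    ∃ i : ℕ → X → ℕ, (∀ n, Measurable (i n)) ∧ (∀ n x, i n x ≤ n) ∧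
      (∀ x, Monotone fun n => h x * (u (i n x)).1 - (u (i n x)).2) ∧
      ∀ n x, h x * (u n).1 - (u n).2 ≤ h x * (u (i n x)).1 - (u (i n x)).2 := by
  classical
  let v : ℕ → X → ℝ := fun k x => h x * (u k).1 - (u k).2
  -- Running argmax: the new index replaces the old one only on strict improvement.
  let i : ℕ → X → ℕ := fun n x =>
    Nat.rec 0 (fun m j => if v j x < v (m + 1) x then m + 1 else j) n
  have hsucc : ∀ n x, i (n + 1) x = if v (i n x) x < v (n + 1) x then n + 1 else i n x :=
    fun n x => rfl
  have hv : ∀ k, Measurable (v k) := fun k => (hh.mul_const _).sub_const _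
  have hvi : ∀ j : X → ℕ, Measurable j → Measurable fun x => v (j x) x := fun j hj =>
    (measurable_from_prod_countable_right (f := fun p : ℕ × X => v p.1 p.2) hv).comp (hj.prodMk measurable_id)
  have him : ∀ n, Measurable (i n) := by
    intro n
    induction n with
    | zero => exact measurable_const
    | succ n ih =>
      simp_rw [funext (hsucc n)]
      exact Measurable.ite (measurableSet_lt (hvi _ ih) (hv _)) measurable_const ih
  refine ⟨i, him, ?_, fun x => monotone_nat_of_le_succ fun n => ?_, ?_⟩
  · intro n x
    induction n with
    | zero => exact le_rfl
    | succ n ih => rw [hsucc]; split_ifs <;> omega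
  · change v (i n x) x ≤ v (i (n + 1) x) x
    rw [hsucc]
    split_ifs with hlt
    · exact hlt.le
    · exact le_rfl
  · intro n x
    change v n x ≤ v (i n x) x
    cases n with
    | zero => exact le_rfl
    | succ n =>
      rw [hsucc]
      split_ifs with hlt
      · exact le_rfl
      · exact not_lt.1 hlt

/-- A supremum of affine functions can be nearly attained, in the sense of integrals, by a
measurable selection with finitely many values. -/
lemma exists_measurable_selection [IsFiniteMeasure ν] {G : Set (ℝ × ℝ)} {h : X → ℝ}
    (hh : Measurable h) (hint : Integrable h ν) {g : X → EReal}
    (hg : ∀ x, g x = ⨆ p : G, ((h x * p.1.1 - p.1.2 : ℝ) : EReal)) (hne : G.Nonempty) {M : ℝ}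
    (hM : (M : EReal) < eintegral ν g) :
    ∃ w : X → ℝ × ℝ, Measurable w ∧ (Set.range w).Finite ∧ (∀ x, w x ∈ G) ∧
      M < ∫ x, (h x * (w x).1 - (w x).2) ∂ν := by
  have : Nonempty G := hne.to_subtype
  let u : ℕ → ℝ × ℝ := fun n => (TopologicalSpace.denseSeq G n : ℝ × ℝ)
  obtain ⟨i, him, hin, hmono, hge⟩ := exists_measurable_argmax u hh
  have hwm : ∀ n, Measurable fun x => u (i n x) := fun n =>
    (measurable_from_top (f := u)).comp (him n)
  have hfin : ∀ n, (Set.range fun x => u (i n x)).Finite := fun n => by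
    refine ((Set.finite_Iic n).image u).subset ?_
    rintro _ ⟨x, rfl⟩
    exact ⟨i n x, hin n x, rfl⟩
  have hbdd : ∀ n, ∃ C, ∀ x, ‖u (i n x)‖ ≤ C := fun n => by
    obtain ⟨C, hC⟩ := (hfin n).isBounded.exists_norm_le
    exact ⟨C, fun x => hC _ ⟨x, rfl⟩⟩
  have hFint : ∀ n, Integrable (fun x => h x * (u (i n x)).1 - (u (i n x)).2) ν := fun n => by
    obtain ⟨C, hC⟩ := hbdd n
    refine Integrable.sub ?_ ?_
    · exact hint.mul_bdd (c := C) (hwm n).fst.aestronglyMeasurable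
        (Eventually.of_forall fun x => (norm_fst_le _).trans (hC x))
    · exact Integrable.of_bound (hwm n).snd.aestronglyMeasurable C
        (Eventually.of_forall fun x => (norm_snd_le _).trans (hC x))
  have hsup : ∀ x, g x = ⨆ n, ((h x * (u (i n x)).1 - (u (i n x)).2 : ℝ) : EReal) := by
    intro x
    rw [hg]
    refine le_antisymm (iSup_le fun p => ?_) (iSup_le fun n => ?_)
    · set B : EReal := ⨆ n, ((h x * (u (i n x)).1 - (u (i n x)).2 : ℝ) : EReal)
      -- The affine value is continuous in p, so a bound along a dense sequence extends to all of G.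
      have hcl : IsClosed {p : G | ((h x * p.1.1 - p.1.2 : ℝ) : EReal) ≤ B} := by
        refine isClosed_le (continuous_coe_real_ereal.comp ?_) continuous_const
        fun_prop
      have hsub : Set.range (TopologicalSpace.denseSeq G)
          ⊆ {p : G | ((h x * p.1.1 - p.1.2 : ℝ) : EReal) ≤ B} := by
        rintro _ ⟨n, rfl⟩
        exact (EReal.coe_le_coe_iff.2 (hge n x)).trans
          (le_iSup (fun n => ((h x * (u (i n x)).1 - (u (i n x)).2 : ℝ) : EReal)) n)
      exact hcl.closure_subset_iff.2 hsub ((TopologicalSpace.denseRange_denseSeq G) p)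
    · exact le_iSup (fun p : G => ((h x * p.1.1 - p.1.2 : ℝ) : EReal))
        (TopologicalSpace.denseSeq G (i n x))
  obtain ⟨n, hn⟩ := exists_lt_integral_of_monotone hFint
    (fun n => (hh.mul (hwm n).fst).sub (hwm n).snd) hmono hsup hM
  exact ⟨fun x => u (i n x), hwm n, hfin n, fun x => (TopologicalSpace.denseSeq G (i n x)).2, hn⟩

end Integral

/-! ### Lipschitz approximation. -/

section Lipschitz

variable {X : Type*} [MetricSpace X] [CompactSpace X]

/-- Continuous functions on a compact space are uniform limits of Lipschitz functions. -/
lemma exists_lipschitz_near [Nonempty X] {h : X → ℝ} (hh : Continuous h) {ε : ℝ} (hε : 0 < ε) :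
    ∃ g ∈ Lip X, ∀ x, |g x - h x| ≤ ε := by
  obtain ⟨δ, hδ, hu⟩ := Metric.uniformContinuous_iff.1
    (CompactSpace.uniformContinuous_of_continuous hh) ε hε
  obtain ⟨C, hC⟩ := (isCompact_range hh).isBounded.exists_norm_le
  have hC' : ∀ x, |h x| ≤ C := fun x => hC _ ⟨x, rfl⟩
  have hC0 : 0 ≤ C := (abs_nonneg _).trans (hC' (Classical.arbitrary X))
  -- Points at distance at least δ are penalised by at least 2C, the largest possible oscillation of
  -- h; so in the infimal convolution below only points where h varies by less than ε can go below
  -- h(x).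
  let K : ℝ≥0 := ⟨2 * C / δ, by positivity⟩
  let g : X → ℝ := fun x => ⨅ y, (h y + K * dist x y)
  have hbdd : ∀ x, BddBelow (Set.range fun y => h y + K * dist x y) := fun x =>
    ⟨-C, by
      rintro _ ⟨y, rfl⟩
      have h1 := (abs_le.1 (hC' y)).1
      have h2 : 0 ≤ K * dist x y := by positivity
      simp only
      linarith⟩
  refine ⟨g, ⟨K, LipschitzWith.of_le_add_mul K fun x y => ?_⟩, fun x => abs_le.2 ⟨?_, ?_⟩⟩
  · rw [← sub_le_iff_le_add]
    refine le_ciInf fun z => ?_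
    rw [sub_le_iff_le_add]
    refine (ciInf_le (hbdd x) z).trans ?_
    have := mul_le_mul_of_nonneg_left (dist_triangle x y z) K.2
    simp only [NNReal.val_eq_coe] at this
    linarith
  · have : h x - ε ≤ g x := by
      refine le_ciInf fun y => ?_
      rcases lt_or_ge (dist x y) δ with hxy | hxy
      · have h1 := hu hxy
        rw [Real.dist_eq] at h1
        have : 0 ≤ K * dist x y := by positivity
        linarith [(abs_lt.1 h1).2]
      · have : 2 * C ≤ K * dist x y := by
          calc 2 * C = 2 * C / δ * δ := by field_simp
            _ ≤ 2 * C / δ * dist x y := mul_le_mul_of_nonneg_left hxy (by positivity)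
        linarith [(abs_le.1 (hC' y)).1, (abs_le.1 (hC' x)).2]
    linarith
  · have : g x ≤ h x := by simpa using ciInf_le (hbdd x) x
    linarith

/-- A bounded measurable function is an almost everywhere limit of Lipschitz functions with the
same bounds. -/
lemma exists_lipschitz_tendsto_ae [Nonempty X] [MeasurableSpace X] [BorelSpace X] (l : Measure X)
    [IsFiniteMeasure l] {g : X → ℝ} (hg : Measurable g) {a b : ℝ} (hab : ∀ x, g x ∈ Set.Icc a b) :
    ∃ f : ℕ → X → ℝ, (∀ n, f n ∈ Lip X) ∧ (∀ n x, f n x ∈ Set.Icc a b) ∧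
      ∀ᵐ x ∂l, Tendsto (fun n => f n x) atTop (nhds (g x)) := by
  have hle : a ≤ b := (hab (Classical.arbitrary X)).1.trans (hab (Classical.arbitrary X)).2
  have hgL : MemLp g 1 l := MemLp.of_bound hg.aestronglyMeasurable (max |a| |b|)
    (Eventually.of_forall fun x => abs_le_max_abs_abs (hab x).1 (hab x).2)
  have hex : ∀ n : ℕ, ∃ f ∈ Lip X, (∀ x, f x ∈ Set.Icc a b) ∧
      eLpNorm (f - g) 1 l ≤ (1 + l Set.univ) * ENNReal.ofReal (1 / (n + 1 : ℝ)) := by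
    intro n
    have hε : 0 < (1 / (n + 1 : ℝ)) := by positivity
    obtain ⟨c, hc, hcL⟩ := hgL.exists_boundedContinuous_eLpNorm_sub_le ENNReal.one_ne_top
      (ε := ENNReal.ofReal (1 / (n + 1 : ℝ))) (by simpa using hε)
    obtain ⟨k, ⟨K, hk⟩, hkc⟩ := exists_lipschitz_near c.continuous hε
    have hcc : Continuous (c : X → ℝ) := c.continuous
    generalize (c : X → ℝ) = c at hc hcL hkc hcc
    -- Clamping to [a, b] is 1-Lipschitz and fixes g, so it preserves both the Lipschitz constant
    -- and the L¹ error.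
    have hm : LipschitzWith K fun x => max a (min b (k x)) := (hk.const_min b).const_max a
    refine ⟨fun x => max a (min b (k x)), ⟨K, hm⟩,
      fun x => ⟨le_max_left _ _, max_le hle (min_le_left _ _)⟩, ?_⟩
    calc eLpNorm ((fun x => max a (min b (k x))) - g) 1 l
        ≤ eLpNorm ((k - c) - (g - c)) 1 l := by
          refine eLpNorm_mono fun x => ?_
          simp only [Pi.sub_apply, sub_sub_sub_cancel_right, Real.norm_eq_abs]
          have e : g x = max a (min b (g x)) := by
            rw [min_eq_right (hab x).2, max_eq_right (hab x).1]
          conv_lhs => rw [e]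
          refine (abs_max_sub_max_le_max a _ a _).trans ?_
          rw [sub_self, abs_zero, max_eq_right (abs_nonneg _)]
          refine (abs_min_sub_min_le_max b _ b _).trans ?_
          rw [sub_self, abs_zero, max_eq_right (abs_nonneg _)]
      _ ≤ eLpNorm (k - c) 1 l + eLpNorm (g - c) 1 l :=
          eLpNorm_sub_le (hk.continuous.sub hcc).aestronglyMeasurable
            (hgL.sub hcL).aestronglyMeasurable le_rfl
      _ ≤ l Set.univ * ENNReal.ofReal (1 / (n + 1 : ℝ)) + ENNReal.ofReal (1 / (n + 1 : ℝ)) := by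
          refine add_le_add ?_ hc
          refine (eLpNorm_le_of_ae_bound (C := 1 / (n + 1 : ℝ))
            (Eventually.of_forall fun x => hkc x)).trans ?_
          simp
      _ = _ := by ring
  choose f hfL hfI hfN using hex
  have hlim : Tendsto (fun n => eLpNorm (f n - g) 1 l) atTop (nhds 0) := by
    refine tendsto_of_tendsto_of_tendsto_of_le_of_le tendsto_const_nhds ?_ (fun _ => zero_le) hfN
    have h1 : Tendsto (fun n : ℕ => ENNReal.ofReal (1 / (n + 1 : ℝ))) atTop (nhds 0) := by
      simpa using ENNReal.tendsto_ofReal tendsto_one_div_add_atTop_nhds_zero_nat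
    simpa using ENNReal.Tendsto.const_mul h1
      (Or.inr (ENNReal.add_ne_top.2 ⟨ENNReal.one_ne_top, measure_ne_top l _⟩))
  have hfm : ∀ n, AEStronglyMeasurable (f n) l := fun n => by
    obtain ⟨K, hK⟩ := hfL n
    exact hK.continuous.aestronglyMeasurable
  obtain ⟨ns, -, hns⟩ := (tendstoInMeasure_of_tendsto_eLpNorm one_ne_zero hfm
    hg.aestronglyMeasurable hlim).exists_seq_tendsto_ae
  exact ⟨fun n => f (ns n), fun n => hfL _, fun n => hfI _, hns⟩

end Lipschitz

/-! ### Weak duality and the variational representation of the divergence. -/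

section Duality

variable {X : Type*} [MeasurableSpace X]

lemma integral_eq_singularPart_add (ξ ν : Measure X) [IsFiniteMeasure ξ] [IsFiniteMeasure ν]
    {h : X → ℝ} (hh : Integrable h ξ) :
    Integrable (fun x => (ξ.rnDeriv ν x).toReal * h x) ν ∧
      ∫ x, h x ∂ξ = ∫ x, h x ∂(ξ.singularPart ν) + ∫ x, (ξ.rnDeriv ν x).toReal * h x ∂ν := by
  have hdec := ξ.haveLebesgueDecomposition_add ν
  have hlt : ∀ᵐ x ∂ν, ξ.rnDeriv ν x < ⊤ := ξ.rnDeriv_lt_top ν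
  have h1 : Integrable h (ξ.singularPart ν) := hh.mono_measure (ξ.singularPart_le ν)
  have h2 : Integrable h (ν.withDensity (ξ.rnDeriv ν)) :=
    hh.mono_measure (ξ.withDensity_rnDeriv_le ν)
  refine ⟨?_, ?_⟩
  · simpa [smul_eq_mul] using
      (integrable_withDensity_iff_integrable_smul' (ξ.measurable_rnDeriv ν) hlt).1 h2
  · conv_lhs => rw [hdec]
    rw [integral_add_measure h1 h2,
      integral_withDensity_eq_integral_toReal_smul (ξ.measurable_rnDeriv ν) hlt]
    simp only [smul_eq_mul]

lemma integrable_of_mem_Icc (ν : Measure X) [IsFiniteMeasure ν] {g : X → ℝ} (hg : Measurable g)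
    {a b : ℝ} (hab : ∀ x, g x ∈ Set.Icc a b) : Integrable g ν :=
  Integrable.of_bound hg.aestronglyMeasurable (max |a| |b|)
    (Eventually.of_forall fun x => abs_le_max_abs_abs (hab x).1 (hab x).2)

lemma toReal_conjPlus_mem_Icc {φ : ℝ → EReal} (hbot : ∀ x, ⊥ < φ x) (hconvex : IsConvex φ)
    (hlsc : LowerSemicontinuous φ) (hone : φ 1 = 0)
    {a b y : ℝ} (hb : (b : EReal) < slopeAtTop φ)
    (hy : y ∈ Set.Icc a b) :
    (conjPlus φ y).toReal ∈ Set.Icc (conjPlus φ a).toReal (conjPlus φ b).toReal := by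
  have hyb : (y : EReal) < slopeAtTop φ := lt_of_le_of_lt (EReal.coe_le_coe_iff.2 hy.2) hb
  have hab : (a : EReal) < slopeAtTop φ := lt_of_le_of_lt (EReal.coe_le_coe_iff.2 hy.1) hyb
  constructor
  · rw [← EReal.coe_le_coe_iff, coe_toReal_conjPlus hbot hconvex hlsc hone hab,
      coe_toReal_conjPlus hbot hconvex hlsc hone hyb]
    exact conjPlus_mono hbot hy.1
  · rw [← EReal.coe_le_coe_iff, coe_toReal_conjPlus hbot hconvex hlsc hone hb,
      coe_toReal_conjPlus hbot hconvex hlsc hone hyb]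
    exact conjPlus_mono hbot hy.2

lemma integrable_toReal_conjPlus {φ : ℝ → EReal} (hbot : ∀ x, ⊥ < φ x) (hconvex : IsConvex φ)
    (hlsc : LowerSemicontinuous φ) (hone : φ 1 = 0)
    (ν : Measure X) [IsFiniteMeasure ν] {g : X → ℝ}
    (hg : Measurable g) {a b : ℝ} (hb : (b : EReal) < slopeAtTop φ)
    (hab : ∀ x, g x ∈ Set.Icc a b) : Integrable (fun x => (conjPlus φ (g x)).toReal) ν :=
  integrable_of_mem_Icc ν
    (measurable_ereal_toReal.comp ((conjPlus_mono hbot).measurable.comp hg))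
    fun x => toReal_conjPlus_mem_Icc hbot hconvex hlsc hone hb (hab x)

lemma eintegral_conjPlus {φ : ℝ → EReal} (hbot : ∀ x, ⊥ < φ x) (hconvex : IsConvex φ)
    (hlsc : LowerSemicontinuous φ) (hone : φ 1 = 0)
    (ν : Measure X) [IsFiniteMeasure ν] {g : X → ℝ}
    (hg : Measurable g) {a b : ℝ} (hb : (b : EReal) < slopeAtTop φ)
    (hab : ∀ x, g x ∈ Set.Icc a b) :
    eintegral ν (fun x => conjPlus φ (g x))
      = ((∫ x, (conjPlus φ (g x)).toReal ∂ν : ℝ) : EReal) := by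
  rw [← eintegral_coe (integrable_toReal_conjPlus hbot hconvex hlsc hone ν hg hb hab)]
  congr 1
  funext x
  exact (coe_toReal_conjPlus hbot hconvex hlsc hone
    (lt_of_le_of_lt (EReal.coe_le_coe_iff.2 (hab x).2) hb)).symm

/-- One affine minorant of φ composed with the integrable density; it rules out the value -∞ for the
integral of φ ∘ dξ/dν. -/
lemma exists_integrable_le_comp_rnDeriv {φ : ℝ → EReal} (hbot : ∀ x, ⊥ < φ x) (hconvex : IsConvex φ)
    (hlsc : LowerSemicontinuous φ) (hone : φ 1 = 0)
    (ξ ν : Measure X) [IsFiniteMeasure ξ] [IsFiniteMeasure ν] :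
    ∃ u : X → ℝ, Measurable u ∧ Integrable u ν ∧
      ∀ x, (u x : EReal) ≤ φ (ξ.rnDeriv ν x).toReal := by
  obtain ⟨y, hy⟩ := exists_lt_slopeAtTop hbot hconvex hlsc hone
  have hp : (y, (conjPlus φ y).toReal) ∈ dualEpi φ :=
    ⟨hy, (coe_toReal_conjPlus hbot hconvex hlsc hone hy).ge⟩
  refine ⟨fun x => (ξ.rnDeriv ν x).toReal * y - (conjPlus φ y).toReal, ?_, ?_, fun x => ?_⟩
  · exact ((ξ.measurable_rnDeriv ν).ennreal_toReal.mul_const _).sub_const _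
  · exact (Measure.integrable_toReal_rnDeriv.mul_const _).sub (integrable_const _)
  · rw [eq_iSup_dualEpi hbot hconvex hlsc hone (r := (ξ.rnDeriv ν x).toReal)
      ENNReal.toReal_nonneg]
    exact le_iSup (fun p : dualEpi φ =>
      (((ξ.rnDeriv ν x).toReal * p.1.1 - p.1.2 : ℝ) : EReal)) ⟨_, hp⟩

lemma bot_lt_eintegral_rnDeriv {φ : ℝ → EReal} (hbot : ∀ x, ⊥ < φ x) (hconvex : IsConvex φ)
    (hlsc : LowerSemicontinuous φ) (hone : φ 1 = 0)
    (ξ ν : Measure X) [IsFiniteMeasure ξ] [IsFiniteMeasure ν] :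
    ⊥ < eintegral ν (fun x => φ (ξ.rnDeriv ν x).toReal) := by
  obtain ⟨u, -, hu, hle⟩ := exists_integrable_le_comp_rnDeriv hbot hconvex hlsc hone ξ ν
  refine lt_of_lt_of_le ?_ (eintegral_mono hle)
  rw [eintegral_coe hu]
  exact EReal.bot_lt_coe _

/-- Weak duality. -/
lemma integral_le_fDiv_add {φ : ℝ → EReal} (hbot : ∀ x, ⊥ < φ x) (hconvex : IsConvex φ)
    (hlsc : LowerSemicontinuous φ) (hone : φ 1 = 0)
    (ξ ν : Measure X) [IsFiniteMeasure ξ] [IsFiniteMeasure ν] {h : X → ℝ}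
    (hh : Measurable h) {a b : ℝ} (hab : ∀ x, h x ∈ Set.Icc a b)
    (hs : ∀ x, (h x : EReal) ≤ slopeAtTop φ) :
    ((∫ x, h x ∂ξ : ℝ) : EReal) ≤ eintegral ν (fun x => conjPlus φ (h x)) + fDiv φ ξ ν := by
  have hφm : Measurable fun x => φ (ξ.rnDeriv ν x).toReal :=
    hlsc.measurable.comp (ξ.measurable_rnDeriv ν).ennreal_toReal
  have hcm : Measurable fun x => conjPlus φ (h x) := (conjPlus_mono hbot).measurable.comp hh
  have hhν := integrable_of_mem_Icc ν hh hab
  have hle : ∀ x, (h x : EReal) ≤ conjPlus φ (h x) := fun x => self_le_conjPlus hone _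
  have hI : ⊥ < eintegral ν (fun x => conjPlus φ (h x)) := by
    refine lt_of_lt_of_le ?_ (eintegral_mono hle)
    rw [eintegral_coe hhν]
    exact EReal.bot_lt_coe _
  obtain ⟨u, hum, hu, hule⟩ := exists_integrable_le_comp_rnDeriv hbot hconvex hlsc hone ξ ν
  have hA := bot_lt_eintegral_rnDeriv hbot hconvex hlsc hone ξ ν
  set σ : ℝ := (ξ.singularPart ν Set.univ).toReal with hσ
  have hσ' : ((ξ.singularPart ν Set.univ : ℝ≥0∞) : EReal) = (σ : EReal) :=
    (EReal.coe_ennreal_toReal (measure_ne_top _ _)).symm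
  have hs0 := bot_lt_slopeAtTop hbot hconvex hlsc hone
  have hσ0 : 0 ≤ σ := ENNReal.toReal_nonneg
  have hdec := integral_eq_singularPart_add ξ ν (integrable_of_mem_Icc ξ hh hab)
  have hsing : ((∫ x, h x ∂(ξ.singularPart ν) : ℝ) : EReal) ≤ slopeAtTop φ * σ := by
    -- Zero singular mass is treated apart because φ'(∞) may be ⊤, and then the product is 0 by
    -- convention.
    rcases hσ0.eq_or_lt with h0 | h0
    · have : ξ.singularPart ν = 0 := by
        rw [← Measure.measure_univ_eq_zero]
        exact ((ENNReal.toReal_eq_zero_iff _).1 h0.symm).resolve_right (measure_ne_top _ _)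
      rw [this, ← h0]
      simp
    · by_cases htop : slopeAtTop φ = ⊤
      · rw [htop, EReal.top_mul_coe_of_pos h0]
        exact le_top
      · obtain ⟨s, hs'⟩ : ∃ s : ℝ, slopeAtTop φ = s := ⟨_, (EReal.coe_toReal htop hs0.ne').symm⟩
        rw [hs', ← EReal.coe_mul, EReal.coe_le_coe_iff]
        have hbd : ∀ x, h x ≤ s := fun x => by
          have := hs x
          rw [hs'] at this
          exact_mod_cast this
        have := integral_mono (μ := ξ.singularPart ν) (integrable_of_mem_Icc _ hh hab)
          (integrable_const s) hbd
        rw [integral_const, smul_eq_mul] at this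
        rw [mul_comm]
        exact this
  unfold fDiv
  rw [hσ']
  have hB : slopeAtTop φ * σ ≠ ⊥ := ((EReal.bot_lt_coe _).trans_le hsing).ne'
  by_cases hIt : eintegral ν (fun x => conjPlus φ (h x)) = ⊤
  · rw [hIt, EReal.top_add_of_ne_bot]
    · exact le_top
    · exact (EReal.bot_lt_add_iff.2 ⟨hA, bot_lt_iff_ne_bot.2 hB⟩).ne'
  by_cases hAt : eintegral ν (fun x => φ (ξ.rnDeriv ν x).toReal) = ⊤
  · rw [hAt, EReal.top_add_of_ne_bot hB, EReal.add_top_of_ne_bot hI.ne']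
    exact le_top
  obtain ⟨H, hHi, hHe, hHint⟩ := exists_integrable_of_eintegral_ne_top hhν hh hcm hle hIt
  obtain ⟨G, hGi, hGe, hGint⟩ := exists_integrable_of_eintegral_ne_top hu hum hφm hule hAt
  rw [hHint, hGint, ← add_assoc, hdec.2, EReal.coe_add, add_comm]
  refine add_le_add ?_ hsing
  rw [← EReal.coe_add, EReal.coe_le_coe_iff, ← integral_add hHi hGi]
  refine integral_mono_ae hdec.1 (hHi.add hGi) ?_
  filter_upwards [hHe, hGe] with x h1 h2
  have := young (φ := φ) (x := (ξ.rnDeriv ν x).toReal) ENNReal.toReal_nonneg (h x)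
  rw [h1, h2, ← EReal.coe_sub, EReal.coe_le_coe_iff] at this
  linarith

/-- The two terms of the divergence live on disjoint sets, so each can be nearly attained
separately: by selected slopes where ν lives and by a constant slope where the singular part lives.
Finitely many values keep g below a single b < φ'(∞). -/
lemma exists_measurable_lt_of_lt_fDiv {φ : ℝ → EReal} (hbot : ∀ x, ⊥ < φ x) (hconvex : IsConvex φ)
    (hlsc : LowerSemicontinuous φ) (hone : φ 1 = 0)
    (ξ ν : Measure X) [IsFiniteMeasure ξ] [IsFiniteMeasure ν]
    {M : ℝ} (hM : (M : EReal) < fDiv φ ξ ν) :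
    ∃ g : X → ℝ, ∃ a b : ℝ, Measurable g ∧ (b : EReal) < slopeAtTop φ ∧
      (∀ x, g x ∈ Set.Icc a b) ∧ M < ∫ x, g x ∂ξ - ∫ x, (conjPlus φ (g x)).toReal ∂ν := by
  set σ : ℝ := (ξ.singularPart ν Set.univ).toReal with hσ
  have hσ' : ((ξ.singularPart ν Set.univ : ℝ≥0∞) : EReal) = (σ : EReal) :=
    (EReal.coe_ennreal_toReal (measure_ne_top _ _)).symm
  have hσ0 : 0 ≤ σ := ENNReal.toReal_nonneg
  obtain ⟨m, t, hm, ht, hmt⟩ : ∃ m t : ℝ,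
      (m : EReal) < eintegral ν (fun x => φ (ξ.rnDeriv ν x).toReal) ∧
      (t : EReal) < slopeAtTop φ * σ ∧ M < m + t := by
    by_contra! hcon
    refine absurd hM (not_lt.2 ?_)
    unfold fDiv
    rw [hσ']
    refine EReal.add_le_of_forall_lt fun a' ha' b' hb' => ?_
    induction a' with
    | bot => simp
    | top => exact absurd ha' not_top_lt
    | coe m =>
      induction b' with
      | bot => simp
      | top => exact absurd hb' not_top_lt
      | coe t => exact_mod_cast hcon m t ha' hb'
  obtain ⟨β, hβ, htβ⟩ : ∃ β : ℝ, (β : EReal) < slopeAtTop φ ∧ t ≤ β * σ := by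
    rcases hσ0.eq_or_lt with h0 | h0
    · obtain ⟨β, hβ⟩ := exists_lt_slopeAtTop hbot hconvex hlsc hone
      rw [← h0] at ht ⊢
      exact ⟨β, hβ, by simpa using ht.le⟩
    · refine ⟨t / σ, ?_, by rw [div_mul_cancel₀ _ h0.ne']⟩
      by_contra! hcon
      refine absurd ht (not_lt.2 ?_)
      refine (mul_le_mul_of_nonneg_right hcon (by exact_mod_cast hσ0)).trans ?_
      rw [← EReal.coe_mul, div_mul_cancel₀ _ h0.ne']
  have hne : (dualEpi φ).Nonempty :=
    ⟨(β, (conjPlus φ β).toReal), hβ, (coe_toReal_conjPlus hbot hconvex hlsc hone hβ).ge⟩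
  have hrm : Measurable fun x => (ξ.rnDeriv ν x).toReal :=
    (ξ.measurable_rnDeriv ν).ennreal_toReal
  obtain ⟨w, hwm, hwf, hwG, hw⟩ := exists_measurable_selection hrm
    Measure.integrable_toReal_rnDeriv
    (fun x => eq_iSup_dualEpi hbot hconvex hlsc hone ENNReal.toReal_nonneg) hne hm
  -- S is null for the singular part and its complement is null for ν.
  obtain ⟨S, hS, hS1, hS2⟩ := ξ.mutuallySingular_singularPart ν
  classical
  let g : X → ℝ := S.piecewise (fun x => (w x).1) fun _ => β
  have hgm : Measurable g := hwm.fst.piecewise hS measurable_const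
  let T : Set ℝ := insert β (Prod.fst '' Set.range w)
  have hTf : T.Finite := (hwf.image _).insert β
  have hTne : T.Nonempty := ⟨β, Set.mem_insert _ _⟩
  have hTs : ∀ y ∈ T, (y : EReal) < slopeAtTop φ := by
    rintro y (rfl | ⟨_, ⟨x, rfl⟩, rfl⟩)
    · exact hβ
    · exact (hwG x).1
  have hgT : ∀ x, g x ∈ T := by
    intro x
    by_cases hx : x ∈ S
    · simp only [g, Set.piecewise_eq_of_mem _ _ _ hx]
      exact Or.inr ⟨_, ⟨x, rfl⟩, rfl⟩
    · simp only [g, Set.piecewise_eq_of_notMem _ _ _ hx]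
      exact Or.inl rfl
  obtain ⟨b, hbT, hb⟩ := Set.exists_max_image T id hTf hTne
  obtain ⟨a, haT, ha⟩ := Set.exists_min_image T id hTf hTne
  have hgI : ∀ x, g x ∈ Set.Icc a b := fun x => ⟨ha _ (hgT x), hb _ (hgT x)⟩
  refine ⟨g, a, b, hgm, hTs b hbT, hgI, hmt.trans_le ?_⟩
  have hdec := integral_eq_singularPart_add ξ ν (integrable_of_mem_Icc ξ hgm hgI)
  have hgν : ∀ᵐ x ∂ν, g x = (w x).1 := by
    have : ∀ᵐ x ∂ν, x ∈ S := by rw [ae_iff]; exact hS2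
    filter_upwards [this] with x hx
    simp only [g, Set.piecewise_eq_of_mem _ _ _ hx]
  have hgs : ∫ x, g x ∂(ξ.singularPart ν) = β * σ := by
    have : ∀ᵐ x ∂(ξ.singularPart ν), g x = β := by
      have : ∀ᵐ x ∂(ξ.singularPart ν), x ∉ S := by rw [ae_iff]; simpa using hS1
      filter_upwards [this] with x hx
      simp only [g, Set.piecewise_eq_of_notMem _ _ _ hx]
    rw [integral_congr_ae this, integral_const, smul_eq_mul, mul_comm]
    rfl
  have hψ := integrable_toReal_conjPlus hbot hconvex hlsc hone ν hgm (hTs b hbT) hgI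
  obtain ⟨C, hC⟩ := hwf.isBounded.exists_norm_le
  have hw2 : Integrable (fun x => (w x).2) ν :=
    Integrable.of_bound hwm.snd.aestronglyMeasurable C
      (Eventually.of_forall fun x => (norm_snd_le _).trans (hC _ ⟨x, rfl⟩))
  have hw1 : Integrable (fun x => (ξ.rnDeriv ν x).toReal * (w x).1) ν :=
    hdec.1.congr (hgν.mono fun x hx => by simp only [hx])
  have hmain : ∫ x, ((ξ.rnDeriv ν x).toReal * (w x).1 - (w x).2) ∂ν
      ≤ ∫ x, ((ξ.rnDeriv ν x).toReal * g x - (conjPlus φ (g x)).toReal) ∂ν := by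
    refine integral_mono_ae (hw1.sub hw2) (hdec.1.sub hψ) ?_
    filter_upwards [hgν] with x hx
    simp only [hx]
    have := (hwG x).2
    rw [← coe_toReal_conjPlus hbot hconvex hlsc hone (hwG x).1, EReal.coe_le_coe_iff] at this
    linarith
  rw [integral_sub hdec.1 hψ] at hmain
  rw [hdec.2, hgs]
  linarith

/-- Lipschitz functions suffice in the variational representation of the divergence. -/
lemma exists_lipschitz_lt_of_lt_fDiv {φ : ℝ → EReal} (hbot : ∀ x, ⊥ < φ x) (hconvex : IsConvex φ)
    (hlsc : LowerSemicontinuous φ) (hone : φ 1 = 0)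
    {X : Type*} [MetricSpace X] [CompactSpace X] [Nonempty X]
    [MeasurableSpace X] [BorelSpace X] (ξ ν : Measure X) [IsFiniteMeasure ξ] [IsFiniteMeasure ν]
    {M : ℝ} (hM : (M : EReal) < fDiv φ ξ ν) :
    ∃ g ∈ Lip X, ∃ a b : ℝ, (b : EReal) < slopeAtTop φ ∧
      (∀ x, g x ∈ Set.Icc a b) ∧ M < ∫ x, g x ∂ξ - ∫ x, (conjPlus φ (g x)).toReal ∂ν := by
  obtain ⟨g, a, b, hgm, hb, hab, hlt⟩ :=
    exists_measurable_lt_of_lt_fDiv hbot hconvex hlsc hone ξ ν hM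
  -- Approximating with respect to ξ + ν gives convergence almost everywhere for both measures along
  -- one sequence.
  obtain ⟨f, hfL, hfI, hfae⟩ := exists_lipschitz_tendsto_ae (ξ + ν) hgm hab
  rw [ae_add_measure_iff] at hfae
  have hfm : ∀ n, Measurable (f n) := fun n => by
    obtain ⟨K, hK⟩ := hfL n
    exact hK.continuous.measurable
  have h1 : Tendsto (fun n => ∫ x, f n x ∂ξ) atTop (nhds (∫ x, g x ∂ξ)) := by
    refine tendsto_integral_of_dominated_convergence (fun _ => max |a| |b|)
      (fun n => (hfm n).aestronglyMeasurable) (integrable_const _) (fun n => ?_) hfae.1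
    exact Eventually.of_forall fun x => abs_le_max_abs_abs (hfI n x).1 (hfI n x).2
  have h2 : Tendsto (fun n => ∫ x, (conjPlus φ (f n x)).toReal ∂ν) atTop
      (nhds (∫ x, (conjPlus φ (g x)).toReal ∂ν)) := by
    refine tendsto_integral_of_dominated_convergence
      (fun _ => max |(conjPlus φ a).toReal| |(conjPlus φ b).toReal|)
      (fun n => (integrable_toReal_conjPlus hbot hconvex hlsc hone ν (hfm n) hb
        (hfI n)).aestronglyMeasurable) (integrable_const _) (fun n => ?_) ?_
    · refine Eventually.of_forall fun x => ?_
      have := toReal_conjPlus_mem_Icc hbot hconvex hlsc hone hb (hfI n x)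
      exact abs_le_max_abs_abs this.1 this.2
    · filter_upwards [hfae.2] with x hx
      have hopen : IsOpen {y : ℝ | (y : EReal) < slopeAtTop φ} :=
        isOpen_lt continuous_coe_real_ereal continuous_const
      have hgx : g x ∈ {y : ℝ | (y : EReal) < slopeAtTop φ} :=
        lt_of_le_of_lt (EReal.coe_le_coe_iff.2 (hab x).2) hb
      exact ((continuousOn_toReal_conjPlus hbot hconvex hlsc hone).continuousAt
        (hopen.mem_nhds hgx)).tendsto.comp hx
  obtain ⟨n, hn⟩ := ((h1.sub h2).eventually_const_lt hlt).exists
  exact ⟨f n, hfL n, a, b, hb, hfI n, hn⟩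

end Duality

/-! ### Supporting lines over mass one. -/

/-- Moving slightly from 1 along the line through another domain point, in either direction, stays
in the domain. The bound 0 ≤ x is kept because densities are nonnegative. -/
lemma exists_mem_both_sides {s : Set ℝ} (h1 : (1 : ℝ) ∈ intrinsicInterior ℝ s) :
    (∀ x ∈ s, x = 1) ∨ ((∃ x ∈ s, 0 ≤ x ∧ x < 1) ∧ ∃ x ∈ s, 1 < x) := by
  by_cases hs : ∀ x ∈ s, x = 1
  · exact Or.inl hs
  right
  push Not at hs
  obtain ⟨z, hz, hz1⟩ := hs
  obtain ⟨p, hp, hp1⟩ := mem_intrinsicInterior.1 h1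
  have hmem : ∀ t : ℝ, AffineMap.lineMap (1 : ℝ) z t ∈ affineSpan ℝ s := fun t =>
    AffineMap.lineMap_mem t (hp1 ▸ p.2) (subset_affineSpan ℝ s hz)
  let L : ℝ → affineSpan ℝ s := fun t => ⟨AffineMap.lineMap (1 : ℝ) z t, hmem t⟩
  have hL : Continuous L := AffineMap.lineMap_continuous.subtype_mk _
  have hL0 : L 0 = p := by
    apply Subtype.ext
    simp [L, hp1]
  have hev : ∀ᶠ t in nhds (0 : ℝ), 1 + t * (z - 1) ∈ s := by
    have h2 : ∀ᶠ t in nhds (0 : ℝ), L t ∈ interior ((↑) ⁻¹' s : Set (affineSpan ℝ s)) :=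
      hL.continuousAt.eventually_mem (by rw [hL0]; exact isOpen_interior.mem_nhds hp)
    filter_upwards [h2] with t ht
    have := interior_subset ht
    simpa [L, AffineMap.lineMap_apply, add_comm] using this
  have hev' : ∀ᶠ t in nhds (0 : ℝ), -1 < t * (z - 1) := by
    have : Tendsto (fun t : ℝ => t * (z - 1)) (nhds 0) (nhds (0 * (z - 1))) :=
      Continuous.tendsto (by fun_prop) 0
    exact this.eventually_const_lt (by simp)
  obtain ⟨ε, hε, hball⟩ := Metric.eventually_nhds_iff.1 (hev.and hev')
  have hp := hball (y := ε / 2) (by simp [abs_of_pos hε]; linarith)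
  have hn := hball (y := -(ε / 2)) (by simp [abs_of_pos hε]; linarith)
  rcases lt_or_gt_of_ne hz1 with hlt | hgt
  · have : 0 < ε / 2 * (1 - z) := mul_pos (by linarith) (by linarith)
    exact ⟨⟨_, hp.1, by linarith [hp.2], by linarith⟩, _, hn.1, by linarith⟩
  · have : 0 < ε / 2 * (z - 1) := mul_pos (by linarith) (by linarith)
    exact ⟨⟨_, hn.1, by linarith [hn.2], by linarith⟩, _, hp.1, by linarith⟩

/-- A convex set in the plane that lies below height `d` over the point `1` lies below some line
through `(1, d)`, provided that it reaches both sides of the vertical line over `1`. -/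
lemma exists_supporting_slope {K : Set (ℝ × ℝ)} (hK : Convex ℝ K) {d : ℝ}
    (hd : ∀ v, ((1, v) : ℝ × ℝ) ∈ K → v ≤ d)
    (hside : (∀ q ∈ K, q.1 = 1) ∨ ((∃ q ∈ K, q.1 < 1) ∧ ∃ q ∈ K, 1 < q.1)) :
    ∃ γ : ℝ, ∀ q ∈ K, q.2 ≤ d + γ * (q.1 - 1) := by
  rcases hside with h | ⟨⟨q₁, hq₁, hlt⟩, q₂, hq₂, hgt⟩
  · refine ⟨0, fun q hq => ?_⟩
    have h1 := h q hq
    have := hd q.2 (by rw [← h1]; exact hq)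
    linarith
  -- Slopes from (1, d) to points on the right are at most those to points on the left: the segment
  -- joining two such points crosses the vertical line over 1 at height at most d.
  · obtain ⟨γ, hγ1, hγ2⟩ := exists_between_of_forall_le
      (s := {y | ∃ q ∈ K, 1 < q.1 ∧ y = (q.2 - d) / (q.1 - 1)})
      (t := {y | ∃ q ∈ K, q.1 < 1 ∧ y = (d - q.2) / (1 - q.1)})
      ⟨_, q₂, hq₂, hgt, rfl⟩ ⟨_, q₁, hq₁, hlt, rfl⟩ (by
        rintro _ ⟨q, hq, hq1, rfl⟩ _ ⟨p, hp, hp1, rfl⟩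
        have hpos : 0 < q.1 - p.1 := by linarith
        have hmem := hK hq hp (a := (1 - p.1) / (q.1 - p.1)) (b := (q.1 - 1) / (q.1 - p.1))
          (div_nonneg (by linarith) hpos.le) (div_nonneg (by linarith) hpos.le)
          (by field_simp; ring)
        have hle := hd ((1 - p.1) / (q.1 - p.1) * q.2 + (q.1 - 1) / (q.1 - p.1) * p.2) (by
          convert hmem using 1
          ext
          · simp only [Prod.fst_add, Prod.smul_fst, smul_eq_mul]
            field_simp
            ring
          · simp)
        rw [div_le_div_iff₀ (by linarith) (by linarith)]
        have e : (1 - p.1) / (q.1 - p.1) * q.2 + (q.1 - 1) / (q.1 - p.1) * p.2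
            = ((1 - p.1) * q.2 + (q.1 - 1) * p.2) / (q.1 - p.1) := by ring
        rw [e, div_le_iff₀ hpos] at hle
        linarith)
    refine ⟨γ, fun q hq => ?_⟩
    rcases lt_trichotomy q.1 1 with h | h | h
    · have := hγ2 ⟨q, hq, h, rfl⟩
      rw [le_div_iff₀ (by linarith)] at this
      linarith
    · have := hd q.2 (by rw [← h]; exact hq)
      rw [h]
      linarith
    · have := hγ1 ⟨q, hq, h, rfl⟩
      rw [div_le_iff₀ (by linarith)] at this
      linarith

/-! ### Candidate measures ρν + tδ_x of arbitrary mass. -/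

section Perturbation

variable {X : Type*} [MeasurableSpace X]

/-- Masses and objective values of the candidates `ρ ν + t δ_x` in the definition of
`tightConj φ ν f`, where `c` dominates `φ ∘ ρ` and no singular mass is allowed if `φ'(∞) = ∞`. -/
def massValueSet (φ : ℝ → EReal) (ν : Measure X) (f : X → ℝ) (x : X) : Set (ℝ × ℝ) :=
  {q | ∃ (ρ c : X → ℝ) (t : ℝ), Measurable ρ ∧ Integrable ρ ν ∧ Integrable c ν ∧
    (∀ z, (ρ z, c z) ∈ epiPlus φ) ∧ 0 ≤ t ∧ (slopeAtTop φ = ⊤ → t = 0) ∧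
    q.1 = ∫ z, ρ z ∂ν + t ∧
    q.2 = ∫ z, ρ z * f z ∂ν - ∫ z, c z ∂ν + t * (f x - (slopeAtTop φ).toReal)}

lemma convex_massValueSet {φ : ℝ → EReal} (hconvex : IsConvex φ) (ν : Measure X)
    [IsFiniteMeasure ν] {f : X → ℝ} (hf : Measurable f) {a b : ℝ} (hab : ∀ z, f z ∈ Set.Icc a b)
    (x : X) : Convex ℝ (massValueSet φ ν f x) := by
  rintro p ⟨ρ₁, c₁, t₁, hm₁, hi₁, hc₁, he₁, ht₁, hs₁, hp1, hp2⟩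
    q ⟨ρ₂, c₂, t₂, hm₂, hi₂, hc₂, he₂, ht₂, hs₂, hq1, hq2⟩ α β hα hβ hαβ
  have hfi : ∀ ρ : X → ℝ, Integrable ρ ν → Integrable (fun z => ρ z * f z) ν := fun ρ hρ =>
    hρ.mul_bdd (c := max |a| |b|) hf.aestronglyMeasurable
      (Eventually.of_forall fun z => abs_le_max_abs_abs (hab z).1 (hab z).2)
  refine ⟨fun z => α * ρ₁ z + β * ρ₂ z, fun z => α * c₁ z + β * c₂ z, α * t₁ + β * t₂,
    (hm₁.const_mul α).add (hm₂.const_mul β), (hi₁.const_mul α).add (hi₂.const_mul β),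
    (hc₁.const_mul α).add (hc₂.const_mul β), fun z => ?_, by positivity, fun h => ?_, ?_, ?_⟩
  · exact convex_epiPlus hconvex (he₁ z) (he₂ z) hα hβ hαβ
  · simp [hs₁ h, hs₂ h]
  · simp only [Prod.fst_add, Prod.smul_fst, smul_eq_mul, hp1, hq1]
    rw [integral_add (hi₁.const_mul α) (hi₂.const_mul β), integral_const_mul, integral_const_mul]
    ring
  · simp only [Prod.snd_add, Prod.smul_snd, smul_eq_mul, hp2, hq2]
    have e : ∀ z, (α * ρ₁ z + β * ρ₂ z) * f z = α * (ρ₁ z * f z) + β * (ρ₂ z * f z) :=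
      fun z => by ring
    simp_rw [e]
    rw [integral_add ((hfi _ hi₁).const_mul α) ((hfi _ hi₂).const_mul β),
      integral_add (hc₁.const_mul α) (hc₂.const_mul β)]
    simp only [integral_const_mul]
    ring

lemma integral_withDensity_add_dirac [MeasurableSingletonClass X] (ν : Measure X)
    [IsFiniteMeasure ν] {ρ : X → ℝ} (hm : Measurable ρ) (hi : Integrable ρ ν)
    (h0 : ∀ z, 0 ≤ ρ z) {t : ℝ} (ht : 0 ≤ t) (x : X) {g : X → ℝ} (hg : Measurable g) {a b : ℝ}
    (hab : ∀ z, g z ∈ Set.Icc a b) :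
    ∫ z, g z ∂(ν.withDensity (fun z => ENNReal.ofReal (ρ z))
        + ENNReal.ofReal t • Measure.dirac x) = ∫ z, ρ z * g z ∂ν + t * g x := by
  have hfin : IsFiniteMeasure (ν.withDensity fun z => ENNReal.ofReal (ρ z)) :=
    isFiniteMeasure_withDensity_ofReal hi.2
  have hfin' : IsFiniteMeasure (ENNReal.ofReal t • Measure.dirac x) :=
    Measure.smul_finite _ ENNReal.ofReal_ne_top
  rw [integral_add_measure (integrable_of_mem_Icc _ hg hab) (integrable_of_mem_Icc _ hg hab),
    integral_withDensity_eq_integral_toReal_smul hm.ennreal_ofReal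
      (Eventually.of_forall fun _ => ENNReal.ofReal_lt_top), integral_smul_measure,
    integral_dirac, ENNReal.toReal_ofReal ht]
  simp only [ENNReal.toReal_ofReal (h0 _), smul_eq_mul]

end Perturbation

lemma exists_forall_mem_Icc_of_mem_Lip {X : Type*} [MetricSpace X] [CompactSpace X]
    {f : X → ℝ} (hf : f ∈ Lip X) :
    ∃ a b : ℝ, ∀ x, f x ∈ Set.Icc a b := by
  obtain ⟨K, hK⟩ := hf
  obtain ⟨C, hC⟩ := (isCompact_range hK.continuous).isBounded.exists_norm_le
  exact ⟨-C, C, fun x => abs_le.1 (hC _ ⟨x, rfl⟩)⟩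

lemma measurable_of_mem_Lip {X : Type*} [MetricSpace X] [MeasurableSpace X] [BorelSpace X]
    {f : X → ℝ} (hf : f ∈ Lip X) : Measurable f := by
  obtain ⟨K, hK⟩ := hf
  exact hK.continuous.measurable

lemma sub_const_mem_Lip {X : Type*} [MetricSpace X] {f : X → ℝ} (hf : f ∈ Lip X) (c : ℝ) :
    (fun x => f x - c) ∈ Lip X := by
  obtain ⟨K, hK⟩ := hf
  exact ⟨K, LipschitzWith.of_dist_le_mul fun x y => by
    simpa [dist_sub_right] using hK.dist_le_mul x y⟩

/-! ### The tight conjugate and the optimal multiplier. -/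

section Main

variable {X : Type*} [MetricSpace X] [CompactSpace X] [MeasurableSpace X] [BorelSpace X]

/-- Weak duality for f - γ; since ξ has mass one, the shift costs exactly γ. -/
lemma tightConj_le {φ : ℝ → EReal} (hbot : ∀ x, ⊥ < φ x) (hconvex : IsConvex φ)
    (hlsc : LowerSemicontinuous φ) (hone : φ 1 = 0)
    (ν : ProbabilityMeasure X) {f : X → ℝ} (hf : f ∈ Lip X) {γ : ℝ}
    (hγ : ∀ x, ((f x - γ : ℝ) : EReal) ≤ slopeAtTop φ) :
    tightConj φ (ν : Measure X) f
      ≤ eintegral (ν : Measure X) (fun x => conjPlus φ (f x - γ)) + (γ : EReal) := by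
  refine iSup_le fun ξ => EReal.sub_le_of_le_add ?_
  have hg := sub_const_mem_Lip hf γ
  obtain ⟨a, b, hab⟩ := exists_forall_mem_Icc_of_mem_Lip hg
  have h := integral_le_fDiv_add hbot hconvex hlsc hone (ξ : Measure X) (ν : Measure X)
    (measurable_of_mem_Lip hg) hab hγ
  obtain ⟨a', b', hab'⟩ := exists_forall_mem_Icc_of_mem_Lip hf
  rw [integral_sub (integrable_of_mem_Icc _ (measurable_of_mem_Lip hf) hab')
    (integrable_const γ)] at h
  simp only [integral_const, probReal_univ, one_smul, EReal.coe_sub] at h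
  have h' := (EReal.sub_le_iff_le_add (Or.inl (EReal.coe_ne_bot γ))
    (Or.inl (EReal.coe_ne_top γ))).1 h
  rwa [add_right_comm] at h'

/-- The point x may be an atom of ν, so the given splitting need not be the Lebesgue decomposition.
The bound is instead checked against each test function of the variational representation, where
Young's inequality handles ρ and g(x) < φ'(∞) handles the Dirac part. -/
lemma fDiv_withDensity_add_dirac_le {φ : ℝ → EReal} (hbot : ∀ x, ⊥ < φ x) (hconvex : IsConvex φ)
    (hlsc : LowerSemicontinuous φ) (hone : φ 1 = 0)
    (ν : Measure X) [IsFiniteMeasure ν] {ρ c : X → ℝ}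
    (hm : Measurable ρ) (hi : Integrable ρ ν) (hc : Integrable c ν)
    (he : ∀ z, (ρ z, c z) ∈ epiPlus φ) {t : ℝ} (ht : 0 ≤ t) (hst : slopeAtTop φ = ⊤ → t = 0)
    (x : X) :
    fDiv φ (ν.withDensity (fun z => ENNReal.ofReal (ρ z)) + ENNReal.ofReal t • Measure.dirac x) ν
      ≤ ((∫ z, c z ∂ν + t * (slopeAtTop φ).toReal : ℝ) : EReal) := by
  have hfin : IsFiniteMeasure (ν.withDensity fun z => ENNReal.ofReal (ρ z)) :=
    isFiniteMeasure_withDensity_ofReal hi.2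
  have hfin' : IsFiniteMeasure (ENNReal.ofReal t • Measure.dirac x) :=
    Measure.smul_finite _ ENNReal.ofReal_ne_top
  have : Nonempty X := ⟨x⟩
  by_contra! hlt
  obtain ⟨g, hg, a, b, hb, hab, hM⟩ :=
    exists_lipschitz_lt_of_lt_fDiv hbot hconvex hlsc hone _ ν hlt
  have hgm := measurable_of_mem_Lip hg
  rw [integral_withDensity_add_dirac ν hm hi (fun z => (he z).1) ht x hgm hab] at hM
  have hψ := integrable_toReal_conjPlus hbot hconvex hlsc hone ν hgm hb hab
  have hρg : Integrable (fun z => ρ z * g z) ν :=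
    hi.mul_bdd (c := max |a| |b|) hgm.aestronglyMeasurable
      (Eventually.of_forall fun z => abs_le_max_abs_abs (hab z).1 (hab z).2)
  have h1 : ∫ z, ρ z * g z ∂ν - ∫ z, (conjPlus φ (g z)).toReal ∂ν ≤ ∫ z, c z ∂ν := by
    rw [← integral_sub hρg hψ]
    refine integral_mono (hρg.sub hψ) hc fun z => ?_
    have h := young_of_mem (he z) (g z)
    rw [← coe_toReal_conjPlus hbot hconvex hlsc hone
      (lt_of_le_of_lt (EReal.coe_le_coe_iff.2 (hab z).2) hb), EReal.coe_le_coe_iff] at h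
    simp only at h ⊢
    linarith
  have h2 : t * g x ≤ t * (slopeAtTop φ).toReal := by
    by_cases htop : slopeAtTop φ = ⊤
    · simp [hst htop]
    · refine mul_le_mul_of_nonneg_left ?_ ht
      have hs := EReal.coe_toReal htop (bot_lt_slopeAtTop hbot hconvex hlsc hone).ne'
      rw [← EReal.coe_le_coe_iff, hs]
      exact (lt_of_le_of_lt (EReal.coe_le_coe_iff.2 (hab x).2) hb).le
  linarith

lemma le_tightConj_of_mem_massValueSet {φ : ℝ → EReal} (hbot : ∀ x, ⊥ < φ x) (hconvex : IsConvex φ)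
    (hlsc : LowerSemicontinuous φ) (hone : φ 1 = 0)
    (ν : ProbabilityMeasure X) {f : X → ℝ} (hf : f ∈ Lip X)
    {x : X} {v : ℝ} (hv : ((1, v) : ℝ × ℝ) ∈ massValueSet φ (ν : Measure X) f x) :
    (v : EReal) ≤ tightConj φ (ν : Measure X) f := by
  obtain ⟨ρ, c, t, hm, hi, hc, he, ht, hst, h1, h2⟩ := hv
  simp only at h1 h2
  set ξ : Measure X := (ν : Measure X).withDensity (fun z => ENNReal.ofReal (ρ z))
    + ENNReal.ofReal t • Measure.dirac x with hξ
  have hprob : IsProbabilityMeasure ξ := by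
    constructor
    rw [hξ, Measure.add_apply, withDensity_apply _ MeasurableSet.univ, Measure.restrict_univ,
      ← ofReal_integral_eq_lintegral_ofReal hi (Eventually.of_forall fun z => (he z).1)]
    simp only [Measure.smul_apply, measure_univ, smul_eq_mul, mul_one]
    rw [← ENNReal.ofReal_add (integral_nonneg fun z => (he z).1) ht, ← h1, ENNReal.ofReal_one]
  refine le_trans ?_ (le_iSup (fun ξ : ProbabilityMeasure X =>
    (((∫ x, f x ∂(ξ : Measure X) : ℝ) : EReal) - fDiv φ (ξ : Measure X) (ν : Measure X)))
    ⟨ξ, hprob⟩)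
  obtain ⟨a, b, hab⟩ := exists_forall_mem_Icc_of_mem_Lip hf
  have hle := fDiv_withDensity_add_dirac_le hbot hconvex hlsc hone (ν : Measure X) hm hi hc he ht
    hst x
  have hint := integral_withDensity_add_dirac (ν : Measure X) hm hi (fun z => (he z).1) ht x
    (measurable_of_mem_Lip hf) hab
  refine le_trans ?_ (EReal.sub_le_sub le_rfl hle)
  simp only [ProbabilityMeasure.coe_mk]
  rw [hint, ← EReal.coe_sub, EReal.coe_le_coe_iff, h2]
  linarith

/-- Bounded above by weak duality with a shift placing f below a real s < φ'(∞), and below by the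
candidate ξ = ν, whose divergence is at most 0. -/
lemma tightConj_eq_coe {φ : ℝ → EReal} (hbot : ∀ x, ⊥ < φ x) (hconvex : IsConvex φ)
    (hlsc : LowerSemicontinuous φ) (hone : φ 1 = 0)
    (ν : ProbabilityMeasure X) {f : X → ℝ} (hf : f ∈ Lip X) :
    ∃ r : ℝ, tightConj φ (ν : Measure X) f = (r : EReal) := by
  have hX : Nonempty X := ν.nonempty
  obtain ⟨a, b, hab⟩ := exists_forall_mem_Icc_of_mem_Lip hf
  obtain ⟨s, hs⟩ := exists_lt_slopeAtTop hbot hconvex hlsc hone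
  have hI : ∀ x, f x - (b - s) ∈ Set.Icc (a - (b - s)) s := fun x =>
    ⟨by linarith [(hab x).1], by linarith [(hab x).2]⟩
  have hup := tightConj_le hbot hconvex hlsc hone ν hf (γ := b - s)
    fun x => (EReal.coe_le_coe_iff.2 (hI x).2).trans hs.le
  rw [eintegral_conjPlus hbot hconvex hlsc hone _
    (measurable_of_mem_Lip (sub_const_mem_Lip hf (b - s))) hs hI, ← EReal.coe_add] at hup
  have hlow := le_tightConj_of_mem_massValueSet hbot hconvex hlsc hone ν hf
    (x := Classical.arbitrary X) (v := ∫ z, f z ∂(ν : Measure X))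
    ⟨fun _ => 1, fun _ => 0, 0, measurable_const, integrable_const _, integrable_const _,
      fun z => ⟨zero_le_one, by simp [hone]⟩, le_rfl, fun _ => rfl, by simp, by simp⟩
  exact ⟨_, (EReal.coe_toReal (hup.trans_lt (EReal.coe_lt_top _)).ne
    ((EReal.bot_lt_coe _).trans_le hlow).ne').symm⟩

/-- Strong duality: an optimal multiplier exists. -/
lemma exists_multiplier {φ : ℝ → EReal} (hbot : ∀ x, ⊥ < φ x) (hconvex : IsConvex φ)
    (hlsc : LowerSemicontinuous φ) (hone : φ 1 = 0)
    (hri : (1 : ℝ) ∈ intrinsicInterior ℝ (effDom φ))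
    (ν : ProbabilityMeasure X) {f : X → ℝ} (hf : f ∈ Lip X) :
    ∃ γ : ℝ, (∀ x, ((f x - γ : ℝ) : EReal) ≤ slopeAtTop φ) ∧
      eintegral (ν : Measure X) (fun x => conjPlus φ (f x - γ)) + (γ : EReal)
        ≤ tightConj φ (ν : Measure X) f := by
  have hX : Nonempty X := ν.nonempty
  obtain ⟨d, hd⟩ := tightConj_eq_coe hbot hconvex hlsc hone ν hf
  have hfm := measurable_of_mem_Lip hf
  obtain ⟨a, b, hab⟩ := exists_forall_mem_Icc_of_mem_Lip hf
  -- Singular mass is placed at a maximiser of f, so that the constraint on γ read off there holds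
  -- everywhere.
  obtain ⟨x, hx⟩ : ∃ x, ∀ z, f z ≤ f x := by
    obtain ⟨K, hK⟩ := hf
    obtain ⟨x, -, hx⟩ := isCompact_univ.exists_isMaxOn Set.univ_nonempty hK.continuous.continuousOn
    exact ⟨x, fun z => hx (Set.mem_univ z)⟩
  set ν' : Measure X := (ν : Measure X) with hν'
  have hconst : ∀ r ∈ effDom φ, 0 ≤ r → ∃ q ∈ massValueSet φ ν' f x, q.1 = r := by
    intro r hr hr0
    refine ⟨(r, _), ⟨fun _ => r, fun _ => (φ r).toReal, 0, measurable_const, integrable_const _,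
      integrable_const _, fun z => ⟨hr0, ?_⟩, le_rfl, fun _ => rfl, by simp, rfl⟩, rfl⟩
    exact (EReal.coe_toReal hr.ne (hbot r).ne').ge
  obtain ⟨γ, hγ⟩ := exists_supporting_slope (convex_massValueSet hconvex ν' hfm hab x) (d := d)
    (fun v hv => by
      have := le_tightConj_of_mem_massValueSet hbot hconvex hlsc hone ν hf hv
      rw [hd] at this
      exact_mod_cast this)
    (by
      -- If the domain is {1}, then φ₊^* is finite everywhere, φ'(∞) = ⊤ forbids singular mass, and
      -- every candidate has mass one. Otherwise constant densities reach both sides.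
      rcases exists_mem_both_sides hri with h | ⟨⟨x₁, h₁, h₁0, h₁1⟩, x₂, h₂, h₂1⟩
      · left
        have hepi : ∀ p ∈ epiPlus φ, p.1 = 1 ∧ 0 ≤ p.2 := by
          intro p hp
          have h1 : p.1 = 1 := h p.1 (hp.2.trans_lt (EReal.coe_lt_top _))
          have h2 := hp.2
          rw [h1, hone] at h2
          exact ⟨h1, by exact_mod_cast h2⟩
        have htop : slopeAtTop φ = ⊤ := by
          refine EReal.eq_top_iff_forall_lt _ |>.2 fun y => ?_
          refine lt_of_lt_of_le (EReal.coe_lt_coe_iff.2 (lt_add_one y))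
            (le_slopeAtTop hbot hconvex hlsc hone (lt_of_le_of_lt (conjPlus_le hbot
              (a := ((y + 1 : ℝ) : EReal)) fun p hp => ?_) (EReal.coe_lt_top _)))
          obtain ⟨e1, e2⟩ := hepi p hp
          rw [EReal.coe_le_coe_iff, e1]
          linarith
        rintro q ⟨ρ, c, t, -, -, -, he, -, hst, hq, -⟩
        rw [hq, hst htop]
        have : ∀ z, ρ z = 1 := fun z => (hepi _ (he z)).1
        simp [this]
      · right
        obtain ⟨q₁, hq₁, e₁⟩ := hconst x₁ h₁ h₁0
        obtain ⟨q₂, hq₂, e₂⟩ := hconst x₂ h₂ (by linarith)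
        exact ⟨⟨q₁, hq₁, by rw [e₁]; exact h₁1⟩, q₂, hq₂, by rw [e₂]; exact h₂1⟩)
  have hfν : Integrable f ν' := integrable_of_mem_Icc ν' hfm hab
  refine ⟨γ, fun z => ?_, ?_⟩
  · by_cases htop : slopeAtTop φ = ⊤
    · rw [htop]
      exact le_top
    · have hs := EReal.coe_toReal htop (bot_lt_slopeAtTop hbot hconvex hlsc hone).ne'
      rw [← hs, EReal.coe_le_coe_iff]
      set s := (slopeAtTop φ).toReal with hsdef
      -- Adding mass t at x to ν changes the height relative to the supporting line by t(f(x) - γ -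
      -- s), which must stay bounded above as t grows.
      have hkey : f x - γ - s ≤ 0 := by
        by_contra! hpos
        have hline : ∀ t : ℝ, 0 ≤ t → ∫ z, f z ∂ν' + t * (f x - γ - s) ≤ d := by
          intro t ht
          have := hγ (1 + t, ∫ z, f z ∂ν' + t * (f x - s)) ⟨fun _ => 1, fun _ => 0, t,
            measurable_const, integrable_const _, integrable_const _,
            fun z => ⟨zero_le_one, by simp [hone]⟩, ht,
            fun h => absurd h htop, by simp, by simp [hsdef]⟩
          simp only at this
          linarith
        have h := hline ((|d - ∫ z, f z ∂ν'| + 1) / (f x - γ - s)) (by positivity)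
        rw [div_mul_cancel₀ _ hpos.ne'] at h
        linarith [le_abs_self (d - ∫ z, f z ∂ν')]
      linarith [hx z]
  · rw [hd]
    by_contra! hlt
    -- A selection from the epigraph nearly attaining this integral gives a density and a cost whose
    -- point would lie above the supporting line.
    have hlt' : ((d - γ : ℝ) : EReal) < eintegral ν' (fun x => conjPlus φ (f x - γ)) := by
      rw [EReal.coe_sub]
      exact EReal.sub_lt_of_lt_add hlt
    have hgm : Measurable fun z => f z - γ := hfm.sub_const γ
    obtain ⟨w, hwm, hwf, hwG, hw⟩ := exists_measurable_selection hgm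
      (hfν.sub (integrable_const γ)) (fun z => conjPlus_eq_iSup hbot (f z - γ))
      ⟨(1, 0), zero_le_one, by simp [hone]⟩ hlt'
    obtain ⟨C, hC⟩ := hwf.isBounded.exists_norm_le
    have hw1 : Integrable (fun z => (w z).1) ν' :=
      Integrable.of_bound hwm.fst.aestronglyMeasurable C
        (Eventually.of_forall fun z => (norm_fst_le _).trans (hC _ ⟨z, rfl⟩))
    have hw2 : Integrable (fun z => (w z).2) ν' :=
      Integrable.of_bound hwm.snd.aestronglyMeasurable C
        (Eventually.of_forall fun z => (norm_snd_le _).trans (hC _ ⟨z, rfl⟩))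
    have hwf' : Integrable (fun z => (w z).1 * f z) ν' :=
      hw1.mul_bdd (c := max |a| |b|) hfm.aestronglyMeasurable
        (Eventually.of_forall fun z => abs_le_max_abs_abs (hab z).1 (hab z).2)
    have h := hγ (∫ z, (w z).1 ∂ν', ∫ z, (w z).1 * f z ∂ν' - ∫ z, (w z).2 ∂ν')
      ⟨fun z => (w z).1, fun z => (w z).2, 0, hwm.fst, hw1, hw2, hwG, le_rfl, fun _ => rfl,
        by simp, by simp⟩
    simp only at h
    have e : ∫ z, ((f z - γ) * (w z).1 - (w z).2) ∂ν'
        = ∫ z, (w z).1 * f z ∂ν' - γ * ∫ z, (w z).1 ∂ν' - ∫ z, (w z).2 ∂ν' := by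
      have hi : Integrable (fun z => (w z).1 * f z - γ * (w z).1) ν' :=
        hwf'.sub (hw1.const_mul γ)
      rw [← integral_const_mul, ← integral_sub hwf' (hw1.const_mul γ), ← integral_sub hi hw2]
      refine integral_congr_ae (Eventually.of_forall fun z => ?_)
      simp only
      ring
    rw [e] at hw
    linarith

/-- Subtracting g(x₀) lowers the integral against μ by g(x₀), and the choice γ = -g(x₀) in the dual
bound compensates exactly. -/
lemma exists_mem_LipAt_lt {φ : ℝ → EReal} (hbot : ∀ x, ⊥ < φ x) (hconvex : IsConvex φ)
    (hlsc : LowerSemicontinuous φ) (hone : φ 1 = 0)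
    (μ ν : ProbabilityMeasure X) (x₀ : X) {M : ℝ}
    (hM : (M : EReal) < fDiv φ (μ : Measure X) (ν : Measure X)) :
    ∃ f ∈ LipAt x₀, (M : EReal) ≤
      ((∫ x, f x ∂(μ : Measure X) : ℝ) : EReal) - tightConj φ (ν : Measure X) f := by
  have : Nonempty X := ⟨x₀⟩
  obtain ⟨g, hg, a, b, hb, hab, hlt⟩ :=
    exists_lipschitz_lt_of_lt_fDiv hbot hconvex hlsc hone (μ : Measure X) (ν : Measure X) hM
  have hgm := measurable_of_mem_Lip hg
  refine ⟨fun x => g x - g x₀, ⟨sub_const_mem_Lip hg _, sub_self _⟩, ?_⟩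
  have hle := tightConj_le hbot hconvex hlsc hone ν (sub_const_mem_Lip hg (g x₀)) (γ := -g x₀)
    fun x => by
      simpa using (lt_of_le_of_lt (EReal.coe_le_coe_iff.2 (hab x).2) hb).le
  simp only [sub_neg_eq_add, sub_add_cancel] at hle
  rw [eintegral_conjPlus hbot hconvex hlsc hone _ hgm hb hab, ← EReal.coe_add] at hle
  refine le_trans ?_ (EReal.sub_le_sub le_rfl hle)
  rw [← EReal.coe_sub, EReal.coe_le_coe_iff,
    integral_sub (integrable_of_mem_Icc _ hgm hab) (integrable_const _)]
  simp only [integral_const, probReal_univ, one_smul]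
  linarith

lemma integral_sub_tightConj_le {φ : ℝ → EReal} (hbot : ∀ x, ⊥ < φ x) (hconvex : IsConvex φ)
    (hlsc : LowerSemicontinuous φ) (hone : φ 1 = 0)
    (μ ν : ProbabilityMeasure X) {f : X → ℝ} (hf : f ∈ Lip X) :
    ((∫ x, f x ∂(μ : Measure X) : ℝ) : EReal) - tightConj φ (ν : Measure X) f
      ≤ fDiv φ (μ : Measure X) (ν : Measure X) := by
  obtain ⟨r, hr⟩ := tightConj_eq_coe hbot hconvex hlsc hone ν hf
  have h : ((∫ x, f x ∂(μ : Measure X) : ℝ) : EReal) - fDiv φ (μ : Measure X) (ν : Measure X)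
      ≤ tightConj φ (ν : Measure X) f :=
    le_iSup (fun ξ : ProbabilityMeasure X =>
      (((∫ x, f x ∂(ξ : Measure X) : ℝ) : EReal) - fDiv φ (ξ : Measure X) (ν : Measure X))) μ
  rw [hr] at h ⊢
  refine EReal.sub_le_of_le_add' ?_
  exact (EReal.sub_le_iff_le_add (Or.inr (EReal.coe_ne_top r)) (Or.inr (EReal.coe_ne_bot r))).1 h

end Main

/-- Turns the constraint on γ into its pointwise form; it holds for every extended real s because γ
is finite. -/
lemma iSup_sub_le_coe_iff {X : Type*} (f : X → ℝ) (s : EReal) (γ : ℝ) :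
    (⨆ x, (f x : EReal)) - s ≤ (γ : EReal) ↔ ∀ x, ((f x - γ : ℝ) : EReal) ≤ s := by
  rw [EReal.sub_le_iff_le_add (Or.inr (EReal.coe_ne_top γ)) (Or.inr (EReal.coe_ne_bot γ)),
    iSup_le_iff]
  refine forall_congr' fun x => ?_
  rw [EReal.coe_sub, EReal.sub_le_iff_le_add (Or.inl (EReal.coe_ne_bot γ))
    (Or.inl (EReal.coe_ne_top γ)), add_comm]

end FDivergence

theorem proposition1 {X : Type*} [MetricSpace X] [CompactSpace X] [MeasurableSpace X]
    [BorelSpace X] (μ ν : ProbabilityMeasure X) (φ : ℝ → EReal)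
    (hproper : FDivergence.IsProper φ) (hconvex : FDivergence.IsConvex φ)
    (hlsc : LowerSemicontinuous φ) (hstrict : FDivergence.IsStrictlyConvexAt φ 1)
    (hone : φ 1 = 0) (hri : (1 : ℝ) ∈ intrinsicInterior ℝ (FDivergence.effDom φ)) :
    FDivergence.fDiv φ (μ : Measure X) (ν : Measure X) =
      (⨆ f ∈ FDivergence.Lip X,
        (((∫ x, f x ∂(μ : Measure X) : ℝ) : EReal)
          - FDivergence.tightConj φ (ν : Measure X) f)) ∧
    (∀ x₀ : X, FDivergence.fDiv φ (μ : Measure X) (ν : Measure X) =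
      (⨆ f ∈ FDivergence.LipAt x₀,
        (((∫ x, f x ∂(μ : Measure X) : ℝ) : EReal)
          - FDivergence.tightConj φ (ν : Measure X) f))) ∧
    (∀ f ∈ FDivergence.Lip X,
      (∃ r : ℝ, FDivergence.tightConj φ (ν : Measure X) f = (r : EReal)) ∧
      IsLeast
        ((fun γ : ℝ =>
            FDivergence.eintegral (ν : Measure X)
              (fun x => FDivergence.conjugate (FDivergence.plusPart φ) (f x - γ))
            + (γ : EReal)) ''
          {γ : ℝ | (⨆ x : X, (f x : EReal)) - FDivergence.slopeAtTop φ ≤ (γ : EReal)})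
        (FDivergence.tightConj φ (ν : Measure X) f)) := by
  have hbot := hproper.2
  have hX : Nonempty X := ν.nonempty
  have hup : ∀ f ∈ FDivergence.Lip X, (((∫ x, f x ∂(μ : Measure X) : ℝ) : EReal)
      - FDivergence.tightConj φ (ν : Measure X) f)
      ≤ FDivergence.fDiv φ (μ : Measure X) (ν : Measure X) := fun f hf =>
    FDivergence.integral_sub_tightConj_le hbot hconvex hlsc hone μ ν hf
  have hlow : ∀ x₀ : X, FDivergence.fDiv φ (μ : Measure X) (ν : Measure X) ≤
      ⨆ f ∈ FDivergence.LipAt x₀, (((∫ x, f x ∂(μ : Measure X) : ℝ) : EReal)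
          - FDivergence.tightConj φ (ν : Measure X) f) := by
    intro x₀
    refine EReal.ge_of_forall_gt_iff_ge.1 fun M hM => ?_
    obtain ⟨f, hf, hle⟩ := FDivergence.exists_mem_LipAt_lt hbot hconvex hlsc hone μ ν x₀ hM
    exact hle.trans (le_iSup₂ (f := fun f (_ : f ∈ FDivergence.LipAt x₀) =>
      (((∫ x, f x ∂(μ : Measure X) : ℝ) : EReal)
        - FDivergence.tightConj φ (ν : Measure X) f)) f hf)
  refine ⟨le_antisymm ?_ (iSup₂_le hup), fun x₀ => le_antisymm (hlow x₀)
    (iSup₂_le fun f hf => hup f hf.1), fun f hf => ⟨?_, ?_, ?_⟩⟩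
  · exact (hlow (Classical.arbitrary X)).trans (iSup₂_le fun f hf =>
      le_iSup₂ (f := fun f (_ : f ∈ FDivergence.Lip X) =>
        (((∫ x, f x ∂(μ : Measure X) : ℝ) : EReal)
          - FDivergence.tightConj φ (ν : Measure X) f)) f hf.1)
  · exact FDivergence.tightConj_eq_coe hbot hconvex hlsc hone ν hf
  · obtain ⟨γ, hγ, hle⟩ := FDivergence.exists_multiplier hbot hconvex hlsc hone hri ν hf
    exact ⟨γ, (FDivergence.iSup_sub_le_coe_iff f _ γ).2 hγ,
      le_antisymm hle (FDivergence.tightConj_le hbot hconvex hlsc hone ν hf hγ)⟩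
  · rintro _ ⟨γ, hγ, rfl⟩
    exact FDivergence.tightConj_le hbot hconvex hlsc hone ν hf
      ((FDivergence.iSup_sub_le_coe_iff f _ γ).1 hγ)
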